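/- Let $\mathbb Z^2_{even}=\{(x,t)\in\mathbb Z^2 : x+t \text{ is even}\}$. To each $z\in\mathbb Z^2_{even}$ attach a rate-one Poisson clock on the dynamical time axis $[0,\infty)$ and an arrow direction $\xi_z^\tau\in\{-1,+1\}$, $\tau\ge 0$: $\xi_z^0$ is uniform on $\{-1,+1\}$, each time the clock at $z$ rings the direction is redrawn uniformly from $\{-1,+1\}$, and $\tau\mapsto\xi_z^\tau$ is right continuous and constant between rings; all clocks, initial directions and redrawn directions are independent. For $\tau\ge 0$ let $S_0^\tau$ be the walk obtained by following the arrows from the origin, i.e. $S_0^\tau(0)=0$ and $S_0^\tau(n+1)=S_0^\tau(n)+\xi^\tau_{(S_0^\tau(n),\,n)}$ for $n\ge 0$. Call a path $\pi$ subdiffusive if there is $K\in(0,\infty)$ such that $\liminf_{n\to\infty}\pi(n)/\sqrt n\ge -K$ or $\limsup_{n\to\infty}\pi(n)/\sqrt n\le K$, and say that $\pi$ obeys the law of the iterated logarithm (LIL) if $\limsup_{n\to\infty}\pi(n)/\sqrt{2n\log\log n}=1$ and $\liminf_{n\to\infty}\pi(n)/\sqrt{2n\log\log n}=-1$. Then,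 almost surely, the set of times $\tau\in[0,\infty)$ at which $S_0^\tau$ is subdiffusive has Hausdorff dimension one. Hence, almost surely, the set of times $\tau\in[0,\infty)$ at which $S_0^\tau$ does not obey the LIL also has Hausdorff dimension one. -/

import Mathlib

open MeasureTheory ProbabilityTheory Filter

namespace DyDW

noncomputable section

/-- The even space-time lattice: points `(x, t)` of `ℤ × ℤ` with `x + t` even. -/
abbrev Site : Type := {z : ℤ × ℤ // Even (z.1 + z.2)}

/-- The space-time origin. -/
def origin : Site := ⟨(0, 0), by simp⟩

/-- The site `(x + s, t + 1)` at the end of the arrow of direction `s = ±1` rooted at `(x, t)`. -/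
def Site.next (z : Site) (s : ℤˣ) : Site :=
  ⟨(z.1.1 + (s : ℤ), z.1.2 + 1), by
    obtain ⟨⟨x, t⟩, h⟩ := z
    obtain ⟨k, hk⟩ := h
    rcases Int.units_eq_one_or s with rfl | rfl
    · exact ⟨k + 1, by simp at hk ⊢; omega⟩
    · exact ⟨k, by simp at hk ⊢; omega⟩⟩

/-- The site reached after `n` steps from `z` by following the arrows of the configuration `ξ`. -/
def follow (ξ : Site → ℤˣ) (z : Site) : ℕ → Site
  | 0 => z
  | n + 1 => (follow ξ z n).next (ξ (follow ξ z n))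

variable {Ω : Type*}

/-- The independent randomness that drives the arrows: at every site there is a rate one Poisson
clock, given by its i.i.d. exponential waiting times `T z 0, T z 1, …`, and a sequence of i.i.d.
symmetric signs: `ε z 0` is the initial direction of the arrow at `z`, and `ε z (n + 1)` is the
direction drawn at the ring that ends the waiting time `T z n`. All these variables are
independent. -/
structure IsDriving [MeasurableSpace Ω] (P : Measure Ω)
    (T : Site → ℕ → Ω → ℝ) (ε : Site → ℕ → Ω → ℤˣ) : Prop where
  hasLaw : ∀ z n, HasLaw (fun ω => (T z n ω, ε z n ω))
    ((expMeasure 1).prod (uniformOn (Set.univ : Set ℤˣ))) P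
  indep : iIndepFun (fun (p : Site × ℕ) ω => (T p.1 p.2 ω, ε p.1 p.2 ω)) P

/-- The dynamical time of the ring number `n` (counted from `0`) of the clock at `z`. -/
def ringTime (T : Site → ℕ → Ω → ℝ) (z : Site) (n : ℕ) (ω : Ω) : ℝ :=
  ∑ k ∈ Finset.range (n + 1), T z k ω

/-- The number of rings of the clock at `z` during `[0, τ]` (almost surely finite for all `τ`). -/
def ringCount (T : Site → ℕ → Ω → ℝ) (z : Site) (τ : ℝ) (ω : Ω) : ℕ :=
  {n : ℕ | ringTime T z n ω ≤ τ}.ncard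

/-- The (right continuous) dynamical arrow configuration: the direction at dynamical time `τ` of
the arrow at `z` is the one drawn at the last ring before or at `τ`. -/
def arrow (T : Site → ℕ → Ω → ℝ) (ε : Site → ℕ → Ω → ℤˣ) (τ : ℝ) (ω : Ω) (z : Site) : ℤˣ :=
  ε z (ringCount T z τ ω) ω

/-- The walk from the origin at dynamical time `τ`: its position at the walk time `n`. -/
def walk (T : Site → ℕ → Ω → ℝ) (ε : Site → ℕ → Ω → ℤˣ) (τ : ℝ) (ω : Ω) (n : ℕ) : ℤ :=
  (follow (arrow T ε τ ω) origin n).1.1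

/-- A path is subdiffusive if, for some `K ∈ (0, ∞)`, `liminf π(t) / √t ≥ -K` or
`limsup π(t) / √t ≤ K`; the lower and upper limits are taken in the extended reals. -/
def Subdiffusive (π : ℕ → ℤ) : Prop :=
  ∃ K : ℝ, 0 < K ∧
    (((-K : ℝ) : EReal) ≤ liminf (fun n : ℕ => (((π n : ℝ) / √(n : ℝ) : ℝ) : EReal)) atTop ∨
      limsup (fun n : ℕ => (((π n : ℝ) / √(n : ℝ) : ℝ) : EReal)) atTop ≤ ((K : ℝ) : EReal))

/-- The path `π` divided by the normalization `√(2 n log log n)` of the law of the iterated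
logarithm, as an extended real. -/
def lilRatio (π : ℕ → ℤ) (n : ℕ) : EReal :=
  (((π n : ℝ) / √(2 * (n : ℝ) * Real.log (Real.log (n : ℝ))) : ℝ) : EReal)

/-- A path obeys the law of the iterated logarithm. -/
def ObeysLIL (π : ℕ → ℤ) : Prop :=
  limsup (lilRatio π) atTop = 1 ∧ liminf (lilRatio π) atTop = -1

end

end DyDW

/-! The proof is a second moment argument in dynamical time. Place deterministic starting points at
the corners of space-time blocks of duration `4 ^ (k₀ + j + 1)` and height `K * 2 ^ (k₀ + j + 1)`.
Walks that follow the same arrows do not cross, so if for every `j` the walk from the `j`-th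
starting point rises by less than the block height during its block, the walk from the origin is
eventually below `4 * K * √n` (`follow_le_sqrt`) and cannot obey the LIL.

Weight each `τ` in `[0, 1]` by a product of Lipschitz cutoffs of the block maxima, normalized to
mean one (`density`). Distinct blocks read arrows on disjoint levels, so the correlation of the
weights at times `s` and `t` is a product over blocks. There the walks are sticky: at a common site
their steps differ with probability `q = flipProb s t`, which is at least a constant times `|s -
t|`; elsewhere they step independently. Couple them with a third walk, independent of the first,
that departs from the second only while the first two are together. Over `r ^ 2` steps the first two
share order `r / q` steps, so the discrepancy is of order `√(r / q)`, small compared with the block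
height once `q * r` is large (`pairAvg_iterate_bump_le`). In the remaining small blocks the
correlation is at most the inverse of the mean cutoff, which is close to one for large `K`. Together
the correlation is at most `1 + δ * |s - t| ^ (-b)` with `b > 0` as small as desired
(`exists_lintegral_density_mul_le`).

Hence the random measures with these densities have bounded expected `α`-energy whenever `α + b <
1`, and an energy argument bounds the dimension from below by `α` (`le_dimH_of_energy_le`). The good
sets are not closed, but their closures add only ring times to the limit, a countable set. Finally
`δ → 0` as `k₀ → ∞`, so the masses concentrate near one and the probability of failure tends to
zero; no zero-one law is needed. -/

namespace DyDW

noncomputable section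

/-! ### Averaging operators, and the coupling of two sticky walkers with an independent one -/

/-- One step of a walker that keeps its position and its running maximum. -/
def walkerStep (w : ℤ × ℤ) (s : ℤˣ) : ℤ × ℤ := (w.1 + s, max w.2 (w.1 + s))

/-- Law of a pair of symmetric signs that differ with probability `q`. -/
def coinWeight (q : ℝ) (a b : ℤˣ) : ℝ := if a = b then (1 - q) / 2 else q / 2

/-- One-step averaging operator of a single walker. -/
def soloAvg (g : ℤ × ℤ → ℝ) (w : ℤ × ℤ) : ℝ := (∑ a : ℤˣ, g (walkerStep w a)) / 2

/-- Joint weight of the next steps of two walkers at `x` and `y`: the steps are independent,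
unless the walkers are at the same place. -/
def pairWeight (q : ℝ) (x y : ℤ) (a b : ℤˣ) : ℝ := if x = y then coinWeight q a b else 1 / 4

/-- One-step averaging operator of two walkers that follow the arrows at two dynamical times. -/
def pairAvg (q : ℝ) (g : (ℤ × ℤ) × (ℤ × ℤ) → ℝ) (σ : (ℤ × ℤ) × (ℤ × ℤ)) : ℝ :=
  ∑ a : ℤˣ, ∑ b : ℤˣ, pairWeight q σ.1.1 σ.2.1 a b * g (walkerStep σ.1 a, walkerStep σ.2 b)

/-- State of the coupling of two sticky walkers with a third one that is independent of the
first: `gap` is the running maximum of the position of the third relative to the second. -/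
structure Coupled where
  fst : ℤ × ℤ
  snd : ℤ × ℤ
  trd : ℤ × ℤ
  gap : ℤ

/-- One step of the coupling. -/
def Coupled.step (σ : Coupled) (a b c : ℤˣ) : Coupled where
  fst := walkerStep σ.fst a
  snd := walkerStep σ.snd (if σ.fst.1 = σ.snd.1 then b else c)
  trd := walkerStep σ.trd c
  gap := max σ.gap
    ((σ.trd.1 + c) - (σ.snd.1 + ((if σ.fst.1 = σ.snd.1 then b else c : ℤˣ) : ℤ)))

/-- One-step averaging operator of the coupling. -/
def coupledAvg (q : ℝ) (g : Coupled → ℝ) (σ : Coupled) : ℝ :=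
  ∑ a : ℤˣ, ∑ b : ℤˣ, ∑ c : ℤˣ, coinWeight q a b / 2 * g (σ.step a b c)

lemma sum_units (g : ℤˣ → ℝ) : ∑ a : ℤˣ, g a = g 1 + g (-1) := by
  rw [UnitsInt.univ, Finset.sum_pair (by decide)]

lemma coinWeight_nonneg {q : ℝ} (h0 : 0 ≤ q) (h1 : q ≤ 1) (a b : ℤˣ) : 0 ≤ coinWeight q a b := by
  unfold coinWeight; split_ifs <;> linarith

lemma coinWeight_values (q : ℝ) : coinWeight q 1 1 = (1 - q) / 2 ∧
    coinWeight q 1 (-1) = q / 2 ∧ coinWeight q (-1) 1 = q / 2 ∧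
    coinWeight q (-1) (-1) = (1 - q) / 2 := by
  have h1 : (1 : ℤˣ) ≠ -1 := by decide
  have h2 : (-1 : ℤˣ) ≠ 1 := by decide
  simp [coinWeight, h1, h2]

lemma soloAvg_eq (g : ℤ × ℤ → ℝ) (w : ℤ × ℤ) :
    soloAvg g w = (g (walkerStep w 1) + g (walkerStep w (-1))) / 2 := by
  rw [soloAvg, sum_units]

lemma coupledAvg_eq (q : ℝ) (g : Coupled → ℝ) (σ : Coupled) :
    coupledAvg q g σ =
      (1 - q) / 4 * (g (σ.step 1 1 1) + g (σ.step 1 1 (-1)) + g (σ.step (-1) (-1) 1)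
        + g (σ.step (-1) (-1) (-1)))
      + q / 4 * (g (σ.step 1 (-1) 1) + g (σ.step 1 (-1) (-1)) + g (σ.step (-1) 1 1)
        + g (σ.step (-1) 1 (-1))) := by
  obtain ⟨h1, h2, h3, h4⟩ := coinWeight_values q
  simp only [coupledAvg, sum_units, h1, h2, h3, h4]
  ring

lemma coupledAvg_mono {q : ℝ} (h0 : 0 ≤ q) (h1 : q ≤ 1) {g h : Coupled → ℝ} {σ : Coupled}
    (H : ∀ a b c, g (σ.step a b c) ≤ h (σ.step a b c)) : coupledAvg q g σ ≤ coupledAvg q h σ := by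
  unfold coupledAvg
  gcongr with a _ b _ c _
  · have := coinWeight_nonneg h0 h1 a b
    positivity
  · exact H a b c

lemma coupledAvg_add_const (q : ℝ) (g : Coupled → ℝ) (c : ℝ) (σ : Coupled) :
    coupledAvg q (fun s => g s + c) σ = coupledAvg q g σ + c := by
  simp only [coupledAvg_eq]; ring

lemma coupledAvg_add_smul (q : ℝ) (g h : Coupled → ℝ) (c : ℝ) :
    coupledAvg q (fun s => g s + c * h s) =
      fun σ => coupledAvg q g σ + c * coupledAvg q h σ := by
  funext σ
  simp only [coupledAvg_eq]; ring

lemma coupledAvg_iterate_add_smul (q : ℝ) (n : ℕ) (g h : Coupled → ℝ) (c : ℝ) :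
    (coupledAvg q)^[n] (fun s => g s + c * h s) =
      fun σ => (coupledAvg q)^[n] g σ + c * (coupledAvg q)^[n] h σ := by
  induction n generalizing g h with
  | zero => rfl
  | succ n ih => simp only [Function.iterate_succ_apply, coupledAvg_add_smul, ih]

/-- States that the coupling can reach. -/
def Coupled.Admissible (σ : Coupled) : Prop :=
  Even (σ.fst.1 - σ.snd.1) ∧ 0 ≤ σ.gap ∧ σ.trd.2 ≤ σ.snd.2 + σ.gap

lemma Coupled.Admissible.step {σ : Coupled} (h : σ.Admissible) (a b c : ℤˣ) :
    (σ.step a b c).Admissible := by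
  obtain ⟨h1, h2, h3⟩ := h
  have key : ∀ a e : ℤˣ, Even (σ.fst.1 + (a : ℤ) - (σ.snd.1 + (e : ℤ))) := by
    intro a e
    rcases Int.units_eq_one_or a with rfl | rfl <;> rcases Int.units_eq_one_or e with rfl | rfl <;>
      · obtain ⟨k, hk⟩ := h1
        simp only [Units.val_one, Units.val_neg, Int.even_iff]
        omega
  refine ⟨key _ _, ?_, ?_⟩
  · simp only [Coupled.step]; omega
  · simp only [Coupled.step, walkerStep]; omega

lemma coupledAvg_iterate_mono {q : ℝ} (h0 : 0 ≤ q) (h1 : q ≤ 1) {g h : Coupled → ℝ}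
    (H : ∀ σ : Coupled, σ.Admissible → g σ ≤ h σ) (n : ℕ) :
    ∀ σ : Coupled, σ.Admissible → (coupledAvg q)^[n] g σ ≤ (coupledAvg q)^[n] h σ := by
  induction n generalizing g h with
  | zero => simpa using H
  | succ n ih =>
    intro σ hσ
    simp only [Function.iterate_succ_apply]
    exact ih (fun σ hσ => coupledAvg_mono h0 h1 fun a b c => H _ (hσ.step a b c)) σ hσ

lemma coupledAvg_iterate_le {q : ℝ} (h0 : 0 ≤ q) (h1 : q ≤ 1) {g : Coupled → ℝ} {c : ℝ}
    (H : ∀ σ : Coupled, σ.Admissible → coupledAvg q g σ ≤ g σ + c) (n : ℕ) :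
    ∀ σ : Coupled, σ.Admissible → (coupledAvg q)^[n] g σ ≤ g σ + n * c := by
  induction n with
  | zero => simp
  | succ n ih =>
    intro σ hσ
    rw [Function.iterate_succ_apply']
    calc _ ≤ coupledAvg q (fun s => g s + n * c) σ :=
          coupledAvg_mono h0 h1 fun a b c => ih _ (hσ.step a b c)
      _ = coupledAvg q g σ + n * c := coupledAvg_add_const _ _ _ _
      _ ≤ _ := by
          have := H σ hσ
          push_cast; linarith

/-- The first two walkers use the signs `(a, b)` when together and the independent signs `(a, c)`
when apart, which is exactly `pairWeight`. -/
lemma coupledAvg_iterate_pair (q : ℝ) (n : ℕ) (g : (ℤ × ℤ) × (ℤ × ℤ) → ℝ) (σ : Coupled) :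
    (coupledAvg q)^[n] (fun s => g (s.fst, s.snd)) σ = (pairAvg q)^[n] g (σ.fst, σ.snd) := by
  induction n generalizing g σ with
  | zero => rfl
  | succ n ih =>
    rw [Function.iterate_succ_apply, Function.iterate_succ_apply, ← ih]
    refine congrFun (congrArg _ (funext fun s => ?_)) σ
    obtain ⟨h1, h2, h3, h4⟩ := coinWeight_values q
    simp only [coupledAvg_eq, pairAvg, sum_units, pairWeight, h1, h2, h3, h4, Coupled.step]
    split_ifs <;> ring

/-- The first walker always uses `a` and the third always uses `c`, which are independent and
uniform. -/
lemma coupledAvg_iterate_prod (q : ℝ) (n : ℕ) (g h : ℤ × ℤ → ℝ) (σ : Coupled) :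
    (coupledAvg q)^[n] (fun s => g s.fst * h s.trd) σ =
      soloAvg^[n] g σ.fst * soloAvg^[n] h σ.trd := by
  induction n generalizing g h σ with
  | zero => rfl
  | succ n ih =>
    rw [Function.iterate_succ_apply, Function.iterate_succ_apply, Function.iterate_succ_apply,
      ← ih]
    refine congrFun (congrArg _ (funext fun s => ?_)) σ
    simp only [coupledAvg_eq, soloAvg_eq, Coupled.step]
    ring

lemma pairAvg_iterate_fst (q : ℝ) (n : ℕ) (g : ℤ × ℤ → ℝ) (σ : (ℤ × ℤ) × (ℤ × ℤ)) :
    (pairAvg q)^[n] (fun s => g s.1) σ = soloAvg^[n] g σ.1 := by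
  have h1 : soloAvg^[n] (fun _ => (1 : ℝ)) = fun _ => 1 := by
    induction n with
    | zero => rfl
    | succ n ih => rw [Function.iterate_succ_apply', ih]; funext s; simp [soloAvg_eq]
  have h2 := coupledAvg_iterate_pair q n (fun s => g s.1) ⟨σ.1, σ.2, (0, 0), 0⟩
  have h3 := coupledAvg_iterate_prod q n g (fun _ => 1) ⟨σ.1, σ.2, (0, 0), 0⟩
  simp only [mul_one, h1] at h2 h3
  rw [← h3, h2]

lemma pairAvg_nonneg {q : ℝ} (h0 : 0 ≤ q) (h1 : q ≤ 1) {g : (ℤ × ℤ) × (ℤ × ℤ) → ℝ}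
    (hg : ∀ s, 0 ≤ g s) (σ : (ℤ × ℤ) × (ℤ × ℤ)) : 0 ≤ pairAvg q g σ := by
  refine Finset.sum_nonneg fun a _ => Finset.sum_nonneg fun b _ => mul_nonneg ?_ (hg _)
  unfold pairWeight
  split_ifs
  · exact coinWeight_nonneg h0 h1 a b
  · norm_num

lemma pairAvg_iterate_nonneg {q : ℝ} (h0 : 0 ≤ q) (h1 : q ≤ 1) (n : ℕ)
    {g : (ℤ × ℤ) × (ℤ × ℤ) → ℝ} (hg : ∀ s, 0 ≤ g s) (σ : (ℤ × ℤ) × (ℤ × ℤ)) :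
    0 ≤ (pairAvg q)^[n] g σ := by
  induction n generalizing g with
  | zero => exact hg σ
  | succ n ih => exact ih (pairAvg_nonneg h0 h1 hg)

lemma pairAvg_mono {q : ℝ} (h0 : 0 ≤ q) (h1 : q ≤ 1) {g h : (ℤ × ℤ) × (ℤ × ℤ) → ℝ}
    (H : ∀ s, g s ≤ h s) (σ : (ℤ × ℤ) × (ℤ × ℤ)) : pairAvg q g σ ≤ pairAvg q h σ := by
  refine Finset.sum_le_sum fun a _ => Finset.sum_le_sum fun b _ =>
    mul_le_mul_of_nonneg_left (H _) ?_
  unfold pairWeight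
  split_ifs
  · exact coinWeight_nonneg h0 h1 a b
  · norm_num

lemma pairAvg_iterate_mono {q : ℝ} (h0 : 0 ≤ q) (h1 : q ≤ 1) (n : ℕ)
    {g h : (ℤ × ℤ) × (ℤ × ℤ) → ℝ} (H : ∀ s, g s ≤ h s) (σ : (ℤ × ℤ) × (ℤ × ℤ)) :
    (pairAvg q)^[n] g σ ≤ (pairAvg q)^[n] h σ := by
  induction n generalizing g h with
  | zero => exact H σ
  | succ n ih => exact ih (pairAvg_mono h0 h1 H)

/-- Potential whose drift controls the running maximum `gap`. -/
def potential (q r : ℝ) (σ : Coupled) : ℝ :=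
  2 * (σ.gap : ℝ) ^ 2 - 4 * σ.gap * (σ.trd.1 - σ.snd.1) + 4 * ((σ.trd.1 : ℝ) - σ.snd.1) ^ 2
    - 4 / q * |(σ.fst.1 : ℝ) - σ.snd.1| + ((σ.fst.1 : ℝ) - σ.snd.1) ^ 2 / (q * r)

/-- When the running maximum moves up to `s`, the quadratic can only decrease: the difference is `2
* (d - s) ^ 2`. So the maximum may be frozen at its old value when drifts are computed. -/
lemma potential_max_le (d s : ℤ) :
    2 * ((max d s : ℤ) : ℝ) ^ 2 - 4 * ((max d s : ℤ) : ℝ) * s ≤ 2 * (d : ℝ) ^ 2 - 4 * d * s := by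
  rcases le_total d s with h | h
  · rw [max_eq_right h]; nlinarith [sq_nonneg ((d : ℝ) - s)]
  · rw [max_eq_left h]

/-- Let `D` be the third position minus the second. It moves only while the first two walkers are
together, where `4 * D ^ 2` drifts by `8`; there the distance of the first two drifts by `2 * q`, so
its coefficient `-4 / q` cancels this exactly. What remains is the drift of the last, quadratic
term, added to absorb the negative distance term later. -/
lemma potential_drift {q r : ℝ} (h0 : 0 < q) (h1 : q ≤ 1) (hr : 0 < r) (σ : Coupled)
    (hσ : σ.Admissible) : coupledAvg q (potential q r) σ ≤ potential q r σ + 4 / (q * r) := by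
  obtain ⟨⟨x, mx⟩, ⟨y, my⟩, ⟨z, mz⟩, d⟩ := σ
  obtain ⟨hev, -, -⟩ := hσ
  have hqr : 0 < q * r := mul_pos h0 hr
  set smooth : ℤˣ → ℤˣ → ℤˣ → ℝ := fun a b c =>
    let e : ℝ := (((if x = y then b else c : ℤˣ) : ℤ) : ℝ)
    2 * (d : ℝ) ^ 2 - 4 * d * ((z + (c : ℤ)) - (y + e)) + 4 * ((z + (c : ℤ)) - (y + e)) ^ 2
      - 4 / q * |(x + (a : ℤ)) - (y + e)| + ((x + (a : ℤ)) - (y + e)) ^ 2 / (q * r) with hs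
  have hle : ∀ a b c, potential q r (Coupled.step ⟨(x, mx), (y, my), (z, mz), d⟩ a b c)
      ≤ smooth a b c := by
    intro a b c
    have := potential_max_le d ((z + c) - (y + ((if x = y then b else c : ℤˣ) : ℤ)))
    simp only [potential, Coupled.step, walkerStep, hs]
    push_cast at this ⊢
    linarith
  rw [coupledAvg_eq]
  have hq' : 0 ≤ (1 - q) / 4 := by linarith
  have hq'' : 0 ≤ q / 4 := by linarith
  refine (add_le_add (mul_le_mul_of_nonneg_left (add_le_add (add_le_add (add_le_add (hle 1 1 1)
    (hle 1 1 (-1))) (hle (-1) (-1) 1)) (hle (-1) (-1) (-1))) hq')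
    (mul_le_mul_of_nonneg_left (add_le_add (add_le_add (add_le_add (hle 1 (-1) 1)
    (hle 1 (-1) (-1))) (hle (-1) 1 1)) (hle (-1) 1 (-1))) hq'')).trans ?_
  simp only [hs, potential]
  by_cases hxy : x = y
  · subst hxy
    simp only [if_true, Units.val_one, Units.val_neg]
    push_cast
    have e1 : (x : ℝ) + 1 - (x + 1) = 0 := by ring
    have e2 : (x : ℝ) + -1 - (x + -1) = 0 := by ring
    have e3 : (x : ℝ) + 1 - (x + -1) = 2 := by ring
    have e4 : (x : ℝ) + -1 - (x + 1) = -2 := by ring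
    rw [e1, e2, e3, e4, sub_self]
    simp only [abs_zero, abs_neg, abs_two]
    -- The squared distance grows by `4 * q` on average from a common site.
    have : q / (q * r) ≤ 1 / (q * r) := by gcongr
    have h5 : (1 / q) * q = 1 := by field_simp
    have h6 : q / (q * r) = q * (1 / (q * r)) := by ring
    have h7 : 4 / (q * r) = 4 * (1 / (q * r)) := by ring
    have h8 : (2:ℝ)^2 / (q * r) = 4 * (1 / (q * r)) := by ring
    have h9 : (-2:ℝ)^2 / (q * r) = 4 * (1 / (q * r)) := by ring
    have h10 : 4 / q = 4 * (1 / q) := by ring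
    rw [h7, h8, h9, h10]
    rw [h6] at this
    generalize 1 / (q * r) = t at *
    generalize 1 / q = u at *
    linear_combination 4 * this - 8 * h5
  · simp only [if_neg hxy, Units.val_one, Units.val_neg]
    push_cast
    -- By parity, distinct walkers are at distance at least `2`, so their difference cannot change
    -- sign in one step and its absolute value has no drift.
    have habs : |(x : ℝ) + 1 - (y + -1)| + |(x : ℝ) + -1 - (y + 1)| = 2 * |(x : ℝ) - y| := by
      obtain ⟨k, hk⟩ := hev
      simp only at hk
      have hk' : (x : ℝ) - y = k + k := by exact_mod_cast hk
      rcases lt_or_gt_of_ne hxy with h | h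
      · have : k ≤ -1 := by omega
        have : (k : ℝ) ≤ -1 := by exact_mod_cast this
        rw [abs_of_nonpos (by linarith), abs_of_nonpos (by linarith), abs_of_nonpos (by linarith)]
        ring
      · have : 1 ≤ k := by omega
        have : (1 : ℝ) ≤ k := by exact_mod_cast this
        rw [abs_of_nonneg (by linarith), abs_of_nonneg (by linarith), abs_of_nonneg (by linarith)]
        ring
    have e1 : (x : ℝ) + 1 - (y + 1) = x - y := by ring
    have e2 : (x : ℝ) + -1 - (y + -1) = x - y := by ring
    rw [e1, e2]
    have h10 : |(x : ℝ) + -1 - (y + 1)| = 2 * |(x : ℝ) - y| - |(x : ℝ) + 1 - (y + -1)| := by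
      linarith
    have h11 : 0 < 1 / (q * r) := by positivity
    rw [h10]
    linear_combination 2 * h11

/-- The starting state of the coupling. -/
def Coupled.start (a : ℤ) : Coupled := ⟨(a, a), (a, a), (a, a), 0⟩

lemma Coupled.start_admissible (a : ℤ) : (Coupled.start a).Admissible := by
  simp [Coupled.Admissible, Coupled.start]

/-- With `D` the third position minus the second, `2 * gap ^ 2 - 4 * gap * D + 4 * D ^ 2 = gap ^ 2 +
(gap - 2 * D) ^ 2`; the negative distance term is absorbed by the quadratic one through the AM-GM
inequality. -/
lemma gap_sq_le {q r : ℝ} (h0 : 0 < q) (hr : 0 < r) (σ : Coupled) :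
    (σ.gap : ℝ) ^ 2 ≤ potential q r σ + 4 * r / q := by
  have h1 : 4 / q * |(σ.fst.1 : ℝ) - σ.snd.1| ≤
      ((σ.fst.1 : ℝ) - σ.snd.1) ^ 2 / (q * r) + 4 * r / q := by
    rw [← sub_nonneg]
    have : ((σ.fst.1 : ℝ) - σ.snd.1) ^ 2 / (q * r) + 4 * r / q
        - 4 / q * |(σ.fst.1 : ℝ) - σ.snd.1| =
        (|(σ.fst.1 : ℝ) - σ.snd.1| - 2 * r) ^ 2 / (q * r) := by
      rw [← sq_abs ((σ.fst.1 : ℝ) - σ.snd.1)]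
      field_simp
      ring
    rw [this]
    positivity
  unfold potential
  nlinarith [sq_nonneg ((σ.gap : ℝ) - 2 * (σ.trd.1 - σ.snd.1))]

/-- The expected running maximum of the gap. -/
lemma coupledAvg_iterate_gap {q r : ℝ} (h0 : 0 < q) (h1 : q ≤ 1) (hr : 0 < r) {n : ℕ}
    (hn : (n : ℝ) = r ^ 2) (a : ℤ) :
    (coupledAvg q)^[n] (fun σ => (σ.gap : ℝ)) (Coupled.start a) ≤ √(8 * r / q) := by
  set l := √(8 * r / q) with hl
  have hl2 : l ^ 2 = 8 * r / q := Real.sq_sqrt (by positivity)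
  have hl0 : 0 < l := Real.sqrt_pos.2 (by positivity)
  -- Instead of Jensen's inequality, the square root is replaced by its tangent, `gap ≤ l / 2 + gap
  -- ^ 2 / (2 * l)`. The term `l / 4` comes from the error in `gap_sq_le`, and the drift accumulated
  -- over `r ^ 2` steps contributes another `l / 4`, for a total of `l`.
  set Φ : Coupled → ℝ := fun σ => (l / 2 + l / 4) + 1 / (2 * l) * potential q r σ with hΦ
  have hle : ∀ σ : Coupled, σ.Admissible → (σ.gap : ℝ) ≤ Φ σ := by
    intro σ _
    have h2 := gap_sq_le h0 hr σ
    have h3 : 4 * r / q = l ^ 2 / 2 := by rw [hl2]; ring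
    rw [h3] at h2
    have h4 : Φ σ - σ.gap = ((potential q r σ + l ^ 2 / 2 - (σ.gap : ℝ) ^ 2)
        + (σ.gap - l) ^ 2) / (2 * l) := by
      simp only [hΦ]; field_simp; ring
    have h5 : 0 ≤ Φ σ - σ.gap := by
      rw [h4]
      have : 0 ≤ potential q r σ + l ^ 2 / 2 - (σ.gap : ℝ) ^ 2 := by linarith
      positivity
    linarith
  have hdrift : ∀ σ : Coupled, σ.Admissible →
      coupledAvg q Φ σ ≤ Φ σ + 1 / (2 * l) * (4 / (q * r)) := by
    intro σ hσ
    have h2 := potential_drift h0 h1 hr σ hσ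
    have h3 := congrFun (coupledAvg_add_smul q (fun _ => l / 2 + l / 4) (potential q r)
      (1 / (2 * l))) σ
    have h4 : coupledAvg q (fun _ => l / 2 + l / 4) σ = l / 2 + l / 4 := by
      rw [coupledAvg_eq]; ring
    rw [h4] at h3
    rw [hΦ, h3]
    have : 1 / (2 * l) * coupledAvg q (potential q r) σ ≤
      1 / (2 * l) * (potential q r σ + 4 / (q * r)) := by gcongr
    simp only
    linarith
  have hst := Coupled.start_admissible a
  refine (coupledAvg_iterate_mono h0.le h1 hle n _ hst).trans
    ((coupledAvg_iterate_le h0.le h1 hdrift n _ hst).trans (le_of_eq ?_))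
  have h6 : potential q r (Coupled.start a) = 0 := by simp [potential, Coupled.start]
  have h7 : (n : ℝ) * (1 / (2 * l) * (4 / (q * r))) = (8 * r / q) / (4 * l) := by
    rw [hn]; field_simp; ring
  rw [h7, ← hl2]
  simp only [hΦ, h6]
  field_simp
  ring

/-! ### The cutoff of the running maximum and its moments -/

/-- The cutoff of the running maximum over a block that starts at height `a` and allows an
increase by `R`. -/
def bump (a R : ℝ) (w : ℤ × ℤ) : ℝ := min 1 (max 0 (1 - (w.2 - a) / R))

lemma bump_nonneg (a R : ℝ) (w : ℤ × ℤ) : 0 ≤ bump a R w := le_min zero_le_one (le_max_left _ _)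

lemma lt_of_bump_pos {a R : ℝ} (hR : 0 < R) {w : ℤ × ℤ} (h : 0 < bump a R w) :
    (w.2 : ℝ) < a + R := by
  rw [bump, lt_min_iff, lt_max_iff] at h
  simp only [lt_irrefl, false_or, sub_pos, div_lt_one hR] at h
  linarith [h.2]

lemma bump_le_one (a R : ℝ) (w : ℤ × ℤ) : bump a R w ≤ 1 := min_le_left _ _

/-- The cutoff is decreasing and `1 / R`-Lipschitz in the maximum, so a one-sided comparison
suffices. This is why a cutoff is used and not an indicator. -/
lemma bump_le_add {a R : ℝ} (hR : 0 < R) {v w : ℤ × ℤ} {d : ℤ} (hd : 0 ≤ d) (h : v.2 ≤ w.2 + d) :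
    bump a R w ≤ bump a R v + d / R := by
  have hd' : (0 : ℝ) ≤ d / R := div_nonneg (by exact_mod_cast hd) hR.le
  have h' : (v.2 : ℝ) ≤ w.2 + d := by exact_mod_cast h
  have h1 : 1 - ((w.2 : ℝ) - a) / R ≤ 1 - (v.2 - a) / R + d / R := by
    have : ((v.2 : ℝ) - a) / R ≤ (w.2 - a) / R + d / R := by
      rw [← add_div]; gcongr; linarith
    linarith
  unfold bump
  rcases min_cases 1 (max 0 (1 - ((v.2 : ℝ) - a) / R)) with ⟨h3, -⟩ | ⟨h3, -⟩ <;> rw [h3]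
  · exact (min_le_left _ _).trans (by linarith)
  · refine (min_le_right _ _).trans (max_le ?_ ?_)
    · exact add_nonneg (le_max_left _ _) hd'
    · exact h1.trans (by gcongr; exact le_max_right _ _)

/-- Near independence of the cutoffs along two sticky walkers. -/
lemma pairAvg_iterate_bump_le {q r R : ℝ} (h0 : 0 < q) (h1 : q ≤ 1) (hr : 0 < r) (hR : 0 < R)
    {n : ℕ} (hn : (n : ℝ) = r ^ 2) (a : ℤ) :
    (pairAvg q)^[n] (fun s => bump a R s.1 * bump a R s.2) ((a, a), (a, a)) ≤
      (soloAvg^[n] (bump a R) (a, a)) ^ 2 + √(8 * r / q) / R := by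
  have e1 := coupledAvg_iterate_pair q n (fun s => bump a R s.1 * bump a R s.2) (Coupled.start a)
  have e2 := coupledAvg_iterate_prod q n (bump a R) (bump a R) (Coupled.start a)
  have e3 := congrFun (coupledAvg_iterate_add_smul q n
    (fun s => bump a R s.fst * bump a R s.trd) (fun s => (s.gap : ℝ)) R⁻¹) (Coupled.start a)
  have e4 := coupledAvg_iterate_mono h0.le h1
    (g := fun s => bump a R s.fst * bump a R s.snd)
    (h := fun s => bump a R s.fst * bump a R s.trd + R⁻¹ * s.gap) (by
      intro σ ⟨_, hd, hm⟩
      have h2 := bump_le_add (a := a) hR hd hm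
      have h3 := bump_le_one a R σ.fst
      have h4 := bump_nonneg a R σ.fst
      have h5 : (0 : ℝ) ≤ σ.gap / R := div_nonneg (by exact_mod_cast hd) hR.le
      rw [mul_comm R⁻¹, ← div_eq_mul_inv]
      nlinarith) n _ (Coupled.start_admissible a)
  have e5 := coupledAvg_iterate_gap h0 h1 hr hn a
  simp only [Coupled.start] at e1 e2 e3 e4 e5
  rw [← e1]
  refine e4.trans ?_
  rw [e3, e2, div_eq_mul_inv, mul_comm _ R⁻¹, sq]
  gcongr

lemma soloAvg_mono {g h : ℤ × ℤ → ℝ} (H : ∀ w, g w ≤ h w) (w : ℤ × ℤ) :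
    soloAvg g w ≤ soloAvg h w := by
  rw [soloAvg_eq, soloAvg_eq]
  linarith [H (walkerStep w 1), H (walkerStep w (-1))]

lemma soloAvg_iterate_mono (n : ℕ) {g h : ℤ × ℤ → ℝ} (H : ∀ w, g w ≤ h w) (w : ℤ × ℤ) :
    soloAvg^[n] g w ≤ soloAvg^[n] h w := by
  induction n generalizing g h with
  | zero => exact H w
  | succ n ih => exact ih (soloAvg_mono H)

/-- Potential for the running maximum of a single walker. -/
def soloPotential (a : ℤ) (w : ℤ × ℤ) : ℝ :=
  2 * ((w.2 : ℝ) - a) ^ 2 - 4 * (w.2 - a) * (w.1 - a) + 4 * ((w.1 : ℝ) - a) ^ 2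

lemma soloPotential_drift (a : ℤ) (w : ℤ × ℤ) :
    soloAvg (soloPotential a) w ≤ soloPotential a w + 4 := by
  rw [soloAvg_eq]
  have h1 := potential_max_le (w.2 - a) (w.1 + 1 - a)
  have h2 := potential_max_le (w.2 - a) (w.1 - 1 - a)
  rw [max_sub_sub_right] at h1 h2
  simp only [soloPotential, walkerStep, Units.val_one, Units.val_neg, ← sub_eq_add_neg]
  push_cast at h1 h2 ⊢
  linarith

/-- The cutoff over a block of `r ^ 2` steps has expectation at least `1 - 2 r / R`. -/
lemma le_soloAvg_iterate_bump {r R : ℝ} (hr : 0 < r) (hR : 0 < R) {n : ℕ} (hn : (n : ℝ) = r ^ 2)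
    (a : ℤ) : 1 - 2 * r / R ≤ soloAvg^[n] (bump a R) (a, a) := by
  -- Tangent bound `m ≤ r + m ^ 2 / (4 * r)` for the rise `m` of the maximum; a drift of at most `4`
  -- per step over `r ^ 2` steps costs the second `r / R`.
  set Ψ : ℤ × ℤ → ℝ := fun w => 1 - r / R - soloPotential a w / (4 * r * R) with hΨ
  have hle : ∀ w, Ψ w ≤ bump a R w := by
    intro w
    have h2 : (((w.2 : ℝ) - a)) ^ 2 ≤ soloPotential a w := by
      unfold soloPotential
      nlinarith [sq_nonneg (((w.2 : ℝ) - a) - 2 * (w.1 - a))]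
    have h3 : ((w.2 : ℝ) - a) / R ≤ r / R + soloPotential a w / (4 * r * R) := by
      have : r / R + soloPotential a w / (4 * r * R) - ((w.2 : ℝ) - a) / R =
        ((soloPotential a w - ((w.2 : ℝ) - a) ^ 2) + (((w.2 : ℝ) - a) - 2 * r) ^ 2)
          / (4 * r * R) := by
        field_simp; ring
      have h4 : 0 ≤ soloPotential a w - ((w.2 : ℝ) - a) ^ 2 := by linarith
      have h5 : 0 ≤ r / R + soloPotential a w / (4 * r * R) - ((w.2 : ℝ) - a) / R := by
        rw [this]; positivity
      linarith
    refine le_min ?_ ?_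
    · have : 0 ≤ soloPotential a w := (sq_nonneg _).trans h2
      have h6 : 0 ≤ soloPotential a w / (4 * r * R) := by positivity
      have h7 : 0 ≤ r / R := by positivity
      simp only [hΨ]; linarith
    · refine le_max_of_le_right ?_
      simp only [hΨ]; linarith
  have hdrift : ∀ n w, Ψ w - n * (1 / (r * R)) ≤ soloAvg^[n] Ψ w := by
    intro n
    induction n with
    | zero => simp
    | succ n ih =>
      intro w
      rw [Function.iterate_succ_apply']
      refine le_trans ?_ (soloAvg_mono ih w)
      have h2 := soloPotential_drift a w
      rw [soloAvg_eq] at h2 ⊢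
      have h3 : (soloPotential a (walkerStep w 1) + soloPotential a (walkerStep w (-1))) / 2
          / (4 * r * R) ≤ (soloPotential a w + 4) / (4 * r * R) := by gcongr
      have h4 : (soloPotential a w + 4) / (4 * r * R) =
        soloPotential a w / (4 * r * R) + 1 / (r * R) := by field_simp
      rw [h4] at h3
      simp only [hΨ]
      push_cast
      rw [div_div, mul_comm 2, ← div_div, add_div] at h3
      linarith
  refine le_trans ?_ ((hdrift n (a, a)).trans (soloAvg_iterate_mono n hle _))
  have h2 : soloPotential a (a, a) = 0 := by simp [soloPotential]
  have h3 : (n : ℝ) * (1 / (r * R)) = r / R := by rw [hn]; field_simp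
  rw [h3]
  simp only [hΨ, h2]
  apply le_of_eq
  ring

/-! ### The product over scales -/

/-- A product of factors that are bounded by a constant close to one, and tend to one along a
geometric progression started at `v`, diverges slowly as `v → 0`. -/
lemma exists_prod_le_one_add_rpow {b C : ℝ} (hb : 0 < b) (hb' : b ≤ 1 / 2) (hC : 0 ≤ C) :
    ∃ A : ℝ, 0 < A ∧ ∀ β : ℝ, 1 ≤ β → β ≤ 2 ^ (b / 2) → ∀ (n : ℕ) (v : ℝ) (ρ : ℕ → ℝ), 0 < v →
      (∀ j, 0 ≤ ρ j) → (∀ j, ρ j ≤ β) → (∀ j, ρ j ≤ 1 + C / √(2 ^ j * v)) →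
      ∏ j ∈ Finset.range n, ρ j ≤ 1 + A * v ^ (-b) := by
  set θ : ℝ := 2 ^ (-b) with hθ
  set θ' : ℝ := 2 ^ (-(b / 2)) with hθ'
  have hθ0 : 0 < θ := by positivity
  have hθ1 : θ < 1 := Real.rpow_lt_one_of_one_lt_of_neg one_lt_two (by linarith)
  have hθ'1 : θ' < 1 := Real.rpow_lt_one_of_one_lt_of_neg one_lt_two (by linarith)
  -- Beyond `v₁` the bound `1 + C / √v` is used, below it the bound `β`. The induction removes the
  -- first factor and replaces `v` by `2 * v`, which multiplies `v ^ (-b)` by `θ`; `A` is large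
  -- enough for the induction step in both regimes.
  set v₁ : ℝ := max 1 ((2 * C / (1 - θ)) ^ 2) with hv₁
  have hv₁1 : 1 ≤ v₁ := le_max_left _ _
  have hv₁0 : 0 < v₁ := by linarith
  set A : ℝ := max (v₁ ^ b / (1 - θ')) (2 * C / (1 - θ)) with hA
  have h1θ : 0 < 1 - θ := by linarith
  have h1θ' : 0 < 1 - θ' := by linarith
  have hA0 : 0 < A := lt_max_of_lt_left (by positivity)
  refine ⟨A, hA0, fun β hβ1 hβ2 n => ?_⟩
  have hβθ : β * θ ≤ θ' := by
    calc β * θ ≤ 2 ^ (b / 2) * θ := by gcongr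
      _ = θ' := by rw [hθ, hθ', ← Real.rpow_add two_pos]; ring_nf
  have hβ3 : β ≤ 2 := hβ2.trans (by
    calc (2 : ℝ) ^ (b / 2) ≤ 2 ^ (1 : ℝ) :=
          Real.rpow_le_rpow_of_exponent_le one_le_two (by linarith)
      _ = 2 := Real.rpow_one 2)
  induction n with
  | zero =>
    intro v ρ hv _ _ _
    have : 0 < v ^ (-b) := by positivity
    simp only [Finset.range_zero, Finset.prod_empty]
    nlinarith
  | succ n ih =>
    intro v ρ hv h0 h1 h2
    rw [Finset.prod_range_succ']
    have ih' := ih (2 * v) (fun j => ρ (j + 1)) (by linarith) (fun j => h0 _) (fun j => h1 _)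
      (fun j => by
        have := h2 (j + 1)
        rwa [pow_succ, mul_assoc] at this)
    set w := v ^ (-b) with hw
    have hw0 : 0 < w := by positivity
    have e1 : (2 * v) ^ (-b) = θ * w := by
      rw [Real.mul_rpow two_pos.le hv.le]
    rw [e1] at ih'
    have hp : 0 ≤ 1 + A * (θ * w) := by positivity
    rcases le_total v v₁ with hvv | hvv
    · calc _ ≤ (1 + A * (θ * w)) * β := mul_le_mul ih' (h1 0) (h0 0) hp
        _ = β + A * w * (β * θ) := by ring
        _ ≤ β + A * w * θ' := by gcongr
        _ ≤ 1 + A * w := by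
          have h3 : 1 ≤ v₁ ^ b * w := by
            rw [hw, Real.rpow_neg hv.le, ← div_eq_mul_inv, one_le_div (by positivity)]
            gcongr
          have h4 : v₁ ^ b ≤ A * (1 - θ') := by
            rw [← div_le_iff₀ h1θ']; exact le_max_left _ _
          have h5 : v₁ ^ b * w ≤ A * (1 - θ') * w := by gcongr
          linarith
    · have hv1 : 1 ≤ v := hv₁1.trans hvv
      -- Here `b ≤ 1 / 2` and `v ≥ 1` enter.
      have h3 : C / √v ≤ C * w := by
        rw [div_eq_mul_inv]
        gcongr
        rw [hw, Real.sqrt_eq_rpow, ← Real.rpow_neg hv.le]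
        exact Real.rpow_le_rpow_of_exponent_le hv1 (by linarith)
      have h4 : C / √v ≤ (1 - θ) / 2 := by
        have : 2 * C / (1 - θ) ≤ √v := by
          refine Real.le_sqrt_of_sq_le ((le_max_right _ _).trans hvv)
        have hs : 0 < √v := Real.sqrt_pos.2 hv
        rw [div_le_iff₀ h1θ] at this
        rw [div_le_iff₀ hs]
        linarith
      have h5 : C ≤ A * (1 - θ) / 2 := by
        have : 2 * C / (1 - θ) ≤ A := le_max_right _ _
        rw [div_le_iff₀ h1θ] at this
        linarith
      have h6 : ρ 0 ≤ 1 + C / √v := by simpa using h2 0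
      have h7 : 0 ≤ C / √v := by positivity
      calc _ ≤ (1 + A * (θ * w)) * (1 + C / √v) := mul_le_mul ih' h6 (h0 0) hp
        _ = 1 + A * (θ * w) + C / √v + A * (θ * w) * (C / √v) := by ring
        _ ≤ 1 + A * (θ * w) + A * (1 - θ) / 2 * w + A * (1 * w) * ((1 - θ) / 2) := by
          gcongr
          exact h3.trans (by gcongr)
        _ = 1 + A * w := by ring

/-! ### Hausdorff dimension from bounded energy -/

open Metric in
/-- A set of Hausdorff measure zero has open covers with small `α`-dimensional content. -/
lemma exists_open_cover_of_hausdorffMeasure_eq_zero {α : ℝ} (hα : 0 < α) {K : Set ℝ}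
    (hK : Measure.hausdorffMeasure α K = 0) {δ : ENNReal} (hδ : δ ≠ 0) :
    ∃ (U : ℕ → Set ℝ) (d : ℕ → ENNReal), (∀ i, IsOpen (U i)) ∧ K ⊆ ⋃ i, U i ∧
      (∀ i, ediam (U i) ≤ d i) ∧ (∀ i, d i ≠ 0) ∧ (∀ i, d i ≠ ⊤) ∧ ∑' i, d i ^ α ≤ δ := by
  have hδ2 : δ / 2 ≠ 0 := by simpa using hδ
  rw [Measure.hausdorffMeasure_apply] at hK
  have h1 := (iSup₂_eq_bot.1 hK) 1 zero_lt_one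
  have h2 : (⨅ (t : ℕ → Set ℝ) (_ : K ⊆ ⋃ n, t n) (_ : ∀ n, ediam (t n) ≤ 1),
      ∑' n, ⨆ _ : (t n).Nonempty, ediam (t n) ^ α) < δ / 2 := by
    rw [h1]; exact pos_iff_ne_zero.2 hδ2
  simp only [iInf_lt_iff] at h2
  obtain ⟨t, htK, htd, hts⟩ := h2
  have hterm : ∀ n, (⨆ _ : (t n).Nonempty, ediam (t n) ^ α) = ediam (t n) ^ α := by
    intro n
    rcases (t n).eq_empty_or_nonempty with h | h
    · simp [h, hα]
    · simp [h]
  simp only [hterm] at hts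
  obtain ⟨δ', hδ'0, hδ's⟩ := ENNReal.exists_pos_sum_of_countable hδ2 ℕ
  -- A small thickening makes the cover open at summable cost, and makes the diameter bounds
  -- nonzero, so that their negative powers are finite.
  have hη : ∀ i, ∃ η : NNReal, 0 < η ∧ (ediam (t i) + 2 * η) ^ α < ediam (t i) ^ α + δ' i := by
    intro i
    have hc : Continuous fun η : NNReal => (ediam (t i) + 2 * (η : ENNReal)) ^ α :=
      ENNReal.continuous_rpow_const.comp (continuous_const.add
        (ENNReal.continuous_const_mul (by simp) |>.comp ENNReal.continuous_coe))
    have hfin : ediam (t i) ^ α ≠ ⊤ :=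
      ENNReal.rpow_ne_top_of_nonneg hα.le ((htd i).trans_lt ENNReal.one_lt_top).ne
    have h0 : (ediam (t i) + 2 * ((0 : NNReal) : ENNReal)) ^ α < ediam (t i) ^ α + δ' i := by
      simpa using ENNReal.lt_add_right hfin (by simpa using (hδ'0 i).ne')
    have hev := hc.continuousAt.eventually_lt (continuousAt_const (x := (0 : NNReal))) h0
    have h3 : ∀ᶠ η : NNReal in nhdsWithin 0 (Set.Ioi 0),
      (ediam (t i) + 2 * (η : ENNReal)) ^ α < ediam (t i) ^ α + δ' i := nhdsWithin_le_nhds hev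
    obtain ⟨η, h4, h5⟩ := (h3.and self_mem_nhdsWithin).exists
    exact ⟨η, h5, h4⟩
  choose η hη0 hηs using hη
  refine ⟨fun i => thickening (η i) (t i), fun i => ediam (t i) + 2 * η i,
    fun i => isOpen_thickening, ?_, fun i => ediam_thickening_le _, ?_, ?_, ?_⟩
  · exact htK.trans (Set.iUnion_mono fun i => self_subset_thickening (by exact_mod_cast hη0 i) _)
  · intro i
    have := (hη0 i).ne'
    simp [this]
  · intro i
    exact ENNReal.add_ne_top.2 ⟨((htd i).trans_lt ENNReal.one_lt_top).ne,
      ENNReal.mul_ne_top (by simp) (by simp)⟩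
  · calc ∑' i, (ediam (t i) + 2 * (η i : ENNReal)) ^ α ≤ ∑' i, (ediam (t i) ^ α + δ' i) :=
        ENNReal.tsum_le_tsum fun i => (hηs i).le
      _ = ∑' i, ediam (t i) ^ α + ∑' i, (δ' i : ENNReal) := ENNReal.tsum_add
      _ ≤ δ / 2 + δ / 2 := add_le_add hts.le hδ's.le
      _ = δ := ENNReal.add_halves δ

/-- The Riesz energy of dimension `α` of a measure on the line. -/
def energy (α : ℝ) (ν : Measure ℝ) : ENNReal := ∫⁻ x, ∫⁻ y, edist x y ^ (-α) ∂ν ∂ν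

open Metric in
/-- The mass of a measure is controlled by its energy and the content of a cover. -/
lemma measure_univ_le_of_cover {α : ℝ} (hα : 0 < α) (ν : Measure ℝ) [IsFiniteMeasure ν]
    {U : ℕ → Set ℝ} {d : ℕ → ENNReal} (hU : ∀ i, IsOpen (U i)) (hUd : ∀ i, ediam (U i) ≤ d i)
    (hd0 : ∀ i, d i ≠ 0) (hdt : ∀ i, d i ≠ ⊤) (hν : ν (⋃ i, U i)ᶜ = 0) {c : ENNReal}
    (hc0 : c ≠ 0) (hct : c ≠ ⊤) :
    ν Set.univ ≤ c * ∑' i, d i ^ α + c⁻¹ * energy α ν := by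
  set V := disjointed U with hV
  have hVm : ∀ i, MeasurableSet (V i) := MeasurableSet.disjointed fun i => (hU i).measurableSet
  have hVU : ∀ i, V i ⊆ U i := disjointed_subset U
  set E : ℕ → ENNReal := fun i => ∫⁻ x in V i, ∫⁻ y, edist x y ^ (-α) ∂ν ∂ν with hE
  have hEsum : ∑' i, E i ≤ energy α ν := by
    rw [hE, ← lintegral_iUnion hVm (disjoint_disjointed U)]
    exact setLIntegral_le_lintegral _ _
  have hdα0 : ∀ i, d i ^ α ≠ 0 := fun i => by simp [hd0 i, hdt i]
  have hdαt : ∀ i, d i ^ α ≠ ⊤ := fun i => ENNReal.rpow_ne_top_of_nonneg hα.le (hdt i)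
  -- Two points of `V i` are at distance at most `d i`, so `1 ≤ d i ^ α * edist x y ^ (-α)` on `V i
  -- × V i`.
  have hsq : ∀ i, ν (V i) * ν (V i) ≤ d i ^ α * E i := by
    intro i
    calc ν (V i) * ν (V i) = ∫⁻ x in V i, ∫⁻ y in V i, 1 ∂ν ∂ν := by simp
      _ ≤ ∫⁻ x in V i, ∫⁻ y in V i, d i ^ α * edist x y ^ (-α) ∂ν ∂ν := by
        refine setLIntegral_mono' (hVm i) fun x hx => setLIntegral_mono' (hVm i) fun y hy => ?_
        have h1 : edist x y ≤ d i :=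
          (edist_le_ediam_of_mem (hVU i hx) (hVU i hy)).trans (hUd i)
        have h2 : d i ^ (-α) ≤ edist x y ^ (-α) := by
          rw [ENNReal.rpow_neg, ENNReal.rpow_neg, ENNReal.inv_le_inv]
          exact ENNReal.rpow_le_rpow h1 hα.le
        calc (1 : ENNReal) = d i ^ α * d i ^ (-α) := by
              rw [← ENNReal.rpow_add _ _ (hd0 i) (hdt i)]; simp
          _ ≤ _ := by gcongr
      _ ≤ ∫⁻ x in V i, ∫⁻ y, d i ^ α * edist x y ^ (-α) ∂ν ∂ν :=
        lintegral_mono fun x => setLIntegral_le_lintegral _ _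
      _ = d i ^ α * E i := by
        simp_rw [lintegral_const_mul' _ _ (hdαt i)]
        rfl
  -- Either the mass is below `c * d i ^ α`, or the quadratic bound can be divided by `d i ^ α`.
  have hone : ∀ i, ν (V i) ≤ c * d i ^ α + c⁻¹ * E i := by
    intro i
    rcases le_total (ν (V i)) (c * d i ^ α) with h | h
    · exact h.trans le_self_add
    · have h1 : d i ^ α * (c * ν (V i)) ≤ d i ^ α * E i :=
        calc d i ^ α * (c * ν (V i)) = (c * d i ^ α) * ν (V i) := by ring
          _ ≤ ν (V i) * ν (V i) := by gcongr
          _ ≤ _ := hsq i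
      have h2 : c * ν (V i) ≤ E i := (ENNReal.mul_le_mul_iff_right (hdα0 i) (hdαt i)).1 h1
      calc ν (V i) = c⁻¹ * (c * ν (V i)) := by
            rw [← mul_assoc, ENNReal.inv_mul_cancel hc0 hct, one_mul]
        _ ≤ c⁻¹ * E i := by gcongr
        _ ≤ _ := le_add_self
  calc ν Set.univ = ν (⋃ i, V i) := by
        rw [hV, iUnion_disjointed, ← measure_add_measure_compl (s := ⋃ i, U i)
          (MeasurableSet.iUnion fun i => (hU i).measurableSet), hν, add_zero]
    _ ≤ ∑' i, ν (V i) := measure_iUnion_le _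
    _ ≤ ∑' i, (c * d i ^ α + c⁻¹ * E i) := ENNReal.tsum_le_tsum hone
    _ = c * ∑' i, d i ^ α + c⁻¹ * ∑' i, E i := by
        rw [ENNReal.tsum_add, ENNReal.tsum_mul_left, ENNReal.tsum_mul_left]
    _ ≤ _ := by gcongr

/-- Lower bound for the Hausdorff dimension of a decreasing intersection from measures of bounded
energy on the sets that are intersected. -/
lemma le_dimH_of_energy_le {α : NNReal} (hα : 0 < α) {A : ℕ → Set ℝ} (hA : Antitone A)
    (hA01 : ∀ n, A n ⊆ Set.Icc 0 1) {D : Set ℝ} (hD : D.Countable)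
    (hcl : (⋂ n, closure (A n)) ⊆ (⋂ n, A n) ∪ D) {ν : ℕ → Measure ℝ}
    [∀ n, IsFiniteMeasure (ν n)] (hν : ∀ n, ν n (A n)ᶜ = 0) {C : ENNReal} (hC : C ≠ ⊤)
    (h : ∃ᶠ n in atTop, 1 / 2 ≤ ν n Set.univ ∧ energy α (ν n) ≤ C) :
    (α : ENNReal) ≤ dimH (⋂ n, A n) := by
  by_contra! hlt
  have hα' : (0 : ℝ) < α := hα
  have hK : dimH (⋂ n, closure (A n)) < α := by
    refine (dimH_mono hcl).trans_lt ?_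
    rw [dimH_union, dimH_countable hD]
    exact max_lt hlt (by exact_mod_cast hα)
  -- With this `c` and the cover chosen below, content and energy contribute at most `1 / 8` each,
  -- less than the mass `1 / 2` in total.
  set c : ENNReal := 8 * (C + 1) with hc
  have hc0 : c ≠ 0 := by simp [hc]
  have hct : c ≠ ⊤ := ENNReal.mul_ne_top (by simp) (by simp [hC])
  obtain ⟨U, d, hUo, hKU, hUd, hd0, hdt, hds⟩ := exists_open_cover_of_hausdorffMeasure_eq_zero
    hα' (hausdorffMeasure_of_dimH_lt hK) (δ := c⁻¹ * 8⁻¹) (by simp [hct])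
  have hanti : Antitone fun n => closure (A n) := fun m n hmn => closure_mono (hA hmn)
  -- By compactness the open cover of the limit set already covers some `closure (A n₀)`, hence
  -- every later `A n`.
  obtain ⟨n₀, hn₀⟩ := exists_subset_nhds_of_isCompact (V := fun n => closure (A n))
    (hanti.directed_ge) (fun n => isCompact_Icc.of_isClosed_subset isClosed_closure
      (closure_minimal (hA01 n) isClosed_Icc)) (U := ⋃ i, U i)
    (fun x hx => (isOpen_iUnion hUo).mem_nhds (hKU hx))
  obtain ⟨n, hn, hmass, hen⟩ := (frequently_atTop.1 h) n₀
  have hsub : A n ⊆ ⋃ i, U i := (hA hn).trans (subset_closure.trans hn₀)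
  have hle := measure_univ_le_of_cover hα' (ν n) hUo hUd hd0 hdt
    (measure_mono_null (Set.compl_subset_compl.2 hsub) (hν n)) hc0 hct
  have h1 : c * ∑' i, d i ^ (α : ℝ) ≤ 8⁻¹ := by
    calc _ ≤ c * (c⁻¹ * 8⁻¹) := by gcongr
      _ = 8⁻¹ := by rw [← mul_assoc, ENNReal.mul_inv_cancel hc0 hct, one_mul]
  have h2 : c⁻¹ * energy α (ν n) ≤ 8⁻¹ := by
    calc _ ≤ c⁻¹ * (C + 1) := by gcongr; exact hen.trans le_self_add
      _ = 8⁻¹ := by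
        rw [hc, ENNReal.mul_inv (by simp) (by simp), mul_assoc, ENNReal.inv_mul_cancel, mul_one]
        · simp
        · simp [hC]
  have h3 := hmass.trans (hle.trans (add_le_add h1 h2))
  have h4 : (8⁻¹ + 8⁻¹ : ENNReal) < 1 / 2 := by
    rw [← ENNReal.toReal_lt_toReal (by simp) (by simp), ENNReal.toReal_add (by simp) (by simp)]
    norm_num
  exact absurd h3 (not_le.2 h4)

/-- Riesz kernels of order less than one are integrable. -/
lemma exists_lintegral_edist_rpow_le {β : ℝ} (hβ : β < 1) :
    ∃ C : ENNReal, C ≠ ⊤ ∧ ∀ s ∈ Set.Icc (0 : ℝ) 1,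
      ∫⁻ t in Set.Icc (0 : ℝ) 1, edist s t ^ (-β) ≤ C := by
  refine ⟨∫⁻ u in Metric.ball (0 : ℝ) 2, edist 0 u ^ (-β), ?_, fun s hs => ?_⟩
  · have hbound_int : IntegrableOn (fun u : ℝ => ‖u‖ ^ (-β)) (Metric.ball 0 2) := by
      refine integrableOn_ball_of_norm_le_rpow (by simp) (C := 1) (α := β) (by simpa using hβ)
        (Eventually.of_forall fun x => ?_)
        (measurable_norm.pow_const (-β)).aestronglyMeasurable
      rw [one_mul, Real.norm_of_nonneg (by positivity)]
    have h1 : ∫⁻ u in Metric.ball (0 : ℝ) 2, edist 0 u ^ (-β) =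
        ∫⁻ u in Metric.ball (0 : ℝ) 2, ‖‖u‖ ^ (-β)‖ₑ := by
      refine lintegral_congr_ae (ae_restrict_of_ae ?_)
      have : ∀ᵐ u : ℝ, u ≠ 0 := by simp [ae_iff]
      filter_upwards [this] with u hu
      have hu' : 0 < ‖u‖ := norm_pos_iff.2 hu
      rw [Real.enorm_of_nonneg (by positivity), ← ENNReal.ofReal_rpow_of_pos hu', edist_comm,
        edist_dist, dist_zero_right]
    rw [h1]
    exact hbound_int.2.ne
  · have h1 : ∫⁻ t in Set.Icc (0 : ℝ) 1, edist s t ^ (-β) =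
        ∫⁻ u in (fun u => u + s) ⁻¹' Set.Icc (0 : ℝ) 1, edist 0 u ^ (-β) := by
      have hmp : MeasurePreserving (fun u : ℝ => u + s) := measurePreserving_add_right volume s
      have := hmp.setLIntegral_comp_preimage (s := Set.Icc (0 : ℝ) 1)
        (f := fun t => edist s t ^ (-β)) measurableSet_Icc (by fun_prop)
      rw [← this]
      refine lintegral_congr fun u => ?_
      congr 1
      rw [edist_dist, edist_dist, Real.dist_eq, Real.dist_eq]
      congr 2
      ring
    rw [h1]
    refine lintegral_mono_set fun u hu => ?_
    simp only [Set.mem_preimage, Set.mem_Icc] at hu hs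
    rw [Metric.mem_ball, dist_zero_right, Real.norm_eq_abs, abs_lt]
    constructor <;> linarith [hu.1, hu.2, hs.1, hs.2]

/-! ### Walks on the lattice and the Markov property of two walkers -/

instance : DiscreteMeasurableSpace ℤˣ where
  forall_measurableSet s := ⟨Units.val '' s, DiscreteMeasurableSpace.forall_measurableSet _,
    Set.preimage_image_eq _ Units.val_injective⟩

/-- The highest position visited in the first `n` steps from `z`. -/
def record (ξ : Site → ℤˣ) (z : Site) : ℕ → ℤ
  | 0 => z.1.1
  | n + 1 => max (record ξ z n) (follow ξ z (n + 1)).1.1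

/-- Position and record after `n` steps from `z`. -/
def walker (ξ : Site → ℤˣ) (z : Site) (n : ℕ) : ℤ × ℤ := ((follow ξ z n).1.1, record ξ z n)

lemma follow_level (ξ : Site → ℤˣ) (z : Site) (n : ℕ) : (follow ξ z n).1.2 = z.1.2 + n := by
  induction n with
  | zero => simp [follow]
  | succ n ih => simp only [follow, Site.next, ih]; push_cast; ring

lemma site_ext {u v : Site} (h1 : u.1.1 = v.1.1) (h2 : u.1.2 = v.1.2) : u = v :=
  Subtype.ext (Prod.ext h1 h2)

/-- Only indices in the range of `f` matter: a walker reads just the level it has reached, which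
keeps its position measurable with respect to the lower levels. -/
lemma measurable_eval_of_countable {Ω ι β : Type*} {mΩ : MeasurableSpace Ω} [Countable ι]
    [MeasurableSpace ι] [MeasurableSingletonClass ι] [MeasurableSpace β] {f : Ω → ι}
    (hf : Measurable f) {G : ι → Ω → β} (hG : ∀ u ∈ Set.range f, Measurable (G u)) :
    Measurable fun ω => G (f ω) ω := by
  intro B hB
  have : (fun ω => G (f ω) ω) ⁻¹' B = ⋃ u ∈ Set.range f, f ⁻¹' {u} ∩ G u ⁻¹' B := by
    ext ω
    simp only [Set.mem_preimage, Set.mem_iUnion, Set.mem_inter_iff, Set.mem_singleton_iff]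
    exact ⟨fun h => ⟨f ω, ⟨ω, rfl⟩, rfl, h⟩, fun ⟨u, _, h1, h2⟩ => h1 ▸ h2⟩
  rw [this]
  exact MeasurableSet.biUnion (Set.to_countable _) fun u hu =>
    (hf (measurableSet_singleton u)).inter (hG u hu hB)

lemma measurable_follow {Ω : Type*} {mΩ : MeasurableSpace Ω} {ξ : Ω → Site → ℤˣ} {z : Site}
    {n : ℕ} (h : ∀ u : Site, u.1.2 < z.1.2 + n → Measurable fun ω => ξ ω u) :
    Measurable fun ω => follow (ξ ω) z n := by
  induction n with
  | zero => exact measurable_const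
  | succ n ih =>
    have ih' := ih fun u hu => h u (by push_cast; omega)
    refine measurable_eval_of_countable (G := fun u ω => u.next (ξ ω u)) ih' ?_
    rintro _ ⟨ω, rfl⟩
    have hlt : (follow (ξ ω) z n).1.2 < z.1.2 + (n + 1 : ℕ) := by
      rw [follow_level]; push_cast; omega
    exact (measurable_of_countable (follow (ξ ω) z n).next).comp (h _ hlt)

lemma measurable_walker {Ω : Type*} {mΩ : MeasurableSpace Ω} {ξ : Ω → Site → ℤˣ} {z : Site}
    {n : ℕ} (h : ∀ u : Site, u.1.2 < z.1.2 + n → Measurable fun ω => ξ ω u) :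
    Measurable fun ω => walker (ξ ω) z n := by
  have hpos : ∀ k ≤ n, Measurable fun ω => (follow (ξ ω) z k).1.1 := fun k hk =>
    (measurable_of_countable (fun u : Site => u.1.1)).comp
      (measurable_follow fun u hu => h u (by omega))
  have hrec : ∀ k ≤ n, Measurable fun ω => record (ξ ω) z k := by
    intro k
    induction k with
    | zero => exact fun _ => measurable_const
    | succ k ih => exact fun hk => (ih (by omega)).max (hpos _ hk)
  exact (hpos n le_rfl).prodMk (hrec n le_rfl)

/-- A field of independent pairs of symmetric signs on the lattice, which differ with
probability `q`. -/
structure IsPairField {Ω : Type*} [MeasurableSpace Ω] (P : Measure Ω) (q : ℝ)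
    (η : Site → Ω → ℤˣ × ℤˣ) : Prop where
  measurable : ∀ z, Measurable (η z)
  indep : iIndepFun η P
  law : ∀ z a b, P {ω | η z ω = (a, b)} = ENNReal.ofReal (coinWeight q a b)

/-- The information carried by the signs below a level. -/
abbrev below {Ω : Type*} (η : Site → Ω → ℤˣ × ℤˣ) (l : ℤ) : MeasurableSpace Ω :=
  ⨆ z ∈ {z : Site | z.1.2 < l}, MeasurableSpace.comap (η z) inferInstance

lemma below_mono {Ω : Type*} (η : Site → Ω → ℤˣ × ℤˣ) : Monotone (below η) := fun _ _ h =>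
  biSup_mono fun _ hz => lt_of_lt_of_le hz h

lemma measurable_below {Ω : Type*} {η : Site → Ω → ℤˣ × ℤˣ} {l : ℤ} {z : Site} (h : z.1.2 < l) :
    Measurable[below η l] (η z) :=
  (comap_measurable (η z)).mono (le_biSup (fun z => MeasurableSpace.comap (η z) inferInstance) h)
    le_rfl

lemma measurable_walker_below {Ω : Type*} {η : Site → Ω → ℤˣ × ℤˣ} (z : Site) (n : ℕ) :
    Measurable[below η (z.1.2 + n)]
    fun ω => (walker (fun u => (η u ω).1) z n, walker (fun u => (η u ω).2) z n) := by
  refine Measurable.prodMk ?_ ?_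
  · exact measurable_walker (mΩ := below η (z.1.2 + n)) fun u hu =>
      measurable_fst.comp (measurable_below hu)
  · exact measurable_walker (mΩ := below η (z.1.2 + n)) fun u hu =>
      measurable_snd.comp (measurable_below hu)

section PairField

variable {Ω : Type*} [mΩ : MeasurableSpace Ω] {P : Measure Ω} {q : ℝ} {η : Site → Ω → ℤˣ × ℤˣ}

lemma IsPairField.below_le (h : IsPairField P q η) (l : ℤ) : below η l ≤ mΩ :=
  iSup₂_le fun z _ => (h.measurable z).comap_le

/-- The sites of level `l` are disjoint from those below it. The sites `u` and `v` may coincide, as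
they do when two walkers are together. -/
lemma IsPairField.lintegral_mul (h : IsPairField P q η) {l : ℤ} {H G : Ω → ENNReal} {u v : Site}
    (hu : u.1.2 = l) (hv : v.1.2 = l) (hH : Measurable[below η l] H)
    (hG : Measurable[MeasurableSpace.comap (η u) inferInstance ⊔
      MeasurableSpace.comap (η v) inferInstance] G) :
    ∫⁻ ω, H ω * G ω ∂P = (∫⁻ ω, H ω ∂P) * ∫⁻ ω, G ω ∂P := by
  have hle : ∀ z, MeasurableSpace.comap (η z) inferInstance ≤ mΩ := fun z =>
    (h.measurable z).comap_le
  have hdisj : Disjoint {z : Site | z.1.2 < l} {z : Site | z.1.2 = l} :=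
    Set.disjoint_left.2 fun z h1 h2 => (ne_of_lt h1) h2
  have hind := indep_iSup_of_disjoint hle h.indep hdisj
  refine lintegral_mul_eq_lintegral_mul_lintegral_of_independent_measurableSpace (h.below_le l)
    (iSup₂_le fun z _ => hle z) hind hH (hG.mono (sup_le ?_ ?_) le_rfl)
  · exact le_biSup (fun z => MeasurableSpace.comap (η z) inferInstance) hu
  · exact le_biSup (fun z => MeasurableSpace.comap (η z) inferInstance) hv

lemma IsPairField.measure_fst (h : IsPairField P q η) (h0 : 0 ≤ q) (h1 : q ≤ 1) (u : Site)
    (a : ℤˣ) : P {ω | (η u ω).1 = a} = ENNReal.ofReal (1 / 2) := by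
  have e : {ω | (η u ω).1 = a} = {ω | η u ω = (a, 1)} ∪ {ω | η u ω = (a, -1)} := by
    ext ω
    rcases Int.units_eq_one_or (η u ω).2 with h | h <;>
      simp [Prod.ext_iff, h]
  rw [e, measure_union, h.law, h.law, ← ENNReal.ofReal_add (coinWeight_nonneg h0 h1 _ _)
    (coinWeight_nonneg h0 h1 _ _)]
  · congr 1
    obtain ⟨e1, e2, e3, e4⟩ := coinWeight_values q
    rcases Int.units_eq_one_or a with rfl | rfl
    · rw [e1, e2]; ring
    · rw [e3, e4]; ring
  · rw [Set.disjoint_left]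
    intro ω h1 h2
    have : ((a, 1) : ℤˣ × ℤˣ) = (a, -1) := h1.symm.trans h2
    have h3 : (1 : ℤˣ) = -1 := congrArg Prod.snd this
    exact absurd h3 (by decide)
  · exact h.measurable u (measurableSet_singleton _)

lemma IsPairField.measure_snd (h : IsPairField P q η) (h0 : 0 ≤ q) (h1 : q ≤ 1) (u : Site)
    (b : ℤˣ) : P {ω | (η u ω).2 = b} = ENNReal.ofReal (1 / 2) := by
  have e : {ω | (η u ω).2 = b} = {ω | η u ω = (1, b)} ∪ {ω | η u ω = (-1, b)} := by
    ext ω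
    rcases Int.units_eq_one_or (η u ω).1 with h | h <;>
      simp [Prod.ext_iff, h]
  rw [e, measure_union, h.law, h.law, ← ENNReal.ofReal_add (coinWeight_nonneg h0 h1 _ _)
    (coinWeight_nonneg h0 h1 _ _)]
  · congr 1
    obtain ⟨e1, e2, e3, e4⟩ := coinWeight_values q
    rcases Int.units_eq_one_or b with rfl | rfl
    · rw [e1, e3]; ring
    · rw [e2, e4]; ring
  · rw [Set.disjoint_left]
    intro ω h1 h2
    have : ((1, b) : ℤˣ × ℤˣ) = (-1, b) := h1.symm.trans h2
    have h3 : (1 : ℤˣ) = -1 := congrArg Prod.fst this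
    exact absurd h3 (by decide)
  · exact h.measurable u (measurableSet_singleton _)

/-- On a common level, the two walkers read either one site, with correlated signs, or two distinct
and hence independent sites. -/
lemma IsPairField.measure_pair (h : IsPairField P q η) (h0 : 0 ≤ q) (h1 : q ≤ 1) {u v : Site}
    (huv : u.1.2 = v.1.2) (a b : ℤˣ) :
    P {ω | (η u ω).1 = a ∧ (η v ω).2 = b} = ENNReal.ofReal (pairWeight q u.1.1 v.1.1 a b) := by
  by_cases hx : u.1.1 = v.1.1
  · obtain rfl := site_ext hx huv
    rw [pairWeight, if_pos rfl, ← h.law u a b]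
    simp only [Prod.ext_iff]
  · have hne : u ≠ v := fun e => hx (by rw [e])
    have hind := h.indep.indepFun hne
    have := hind.measure_inter_preimage_eq_mul (Prod.fst ⁻¹' {a}) (Prod.snd ⁻¹' {b})
      (measurable_fst (measurableSet_singleton a)) (measurable_snd (measurableSet_singleton b))
    rw [pairWeight, if_neg hx]
    calc _ = P {ω | (η u ω).1 = a} * P {ω | (η v ω).2 = b} := this
      _ = _ := by
        rw [h.measure_fst h0 h1, h.measure_snd h0 h1, ← ENNReal.ofReal_mul (by norm_num)]
        norm_num

lemma IsPairField.lintegral_pair (h : IsPairField P q η) (h0 : 0 ≤ q) (h1 : q ≤ 1) {u v : Site}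
    (huv : u.1.2 = v.1.2) {φ : ℤˣ → ℤˣ → ℝ} (hφ : ∀ a b, 0 ≤ φ a b) :
    ∫⁻ ω, ENNReal.ofReal (φ (η u ω).1 (η v ω).2) ∂P =
      ENNReal.ofReal (∑ a, ∑ b, pairWeight q u.1.1 v.1.1 a b * φ a b) := by
  have hm : Measurable fun ω => ((η u ω).1, (η v ω).2) :=
    (measurable_fst.comp (h.measurable u)).prodMk (measurable_snd.comp (h.measurable v))
  have hw : ∀ a b, 0 ≤ pairWeight q u.1.1 v.1.1 a b := by
    intro a b
    unfold pairWeight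
    split_ifs
    · exact coinWeight_nonneg h0 h1 a b
    · norm_num
  have e1 := lintegral_map (μ := P) (f := fun p : ℤˣ × ℤˣ => ENNReal.ofReal (φ p.1 p.2))
    (measurable_of_countable _) hm
  rw [← e1, lintegral_fintype, Fintype.sum_prod_type, ENNReal.ofReal_sum_of_nonneg
    fun a _ => Finset.sum_nonneg fun b _ => mul_nonneg (hw a b) (hφ a b)]
  refine Finset.sum_congr rfl fun a _ => ?_
  rw [ENNReal.ofReal_sum_of_nonneg fun b _ => mul_nonneg (hw a b) (hφ a b)]
  refine Finset.sum_congr rfl fun b _ => ?_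
  rw [Measure.map_apply hm (measurableSet_singleton _), ENNReal.ofReal_mul (hw a b),
    ← h.measure_pair h0 h1 huv a b, mul_comm]
  congr 2
  ext ω
  simp [Prod.ext_iff]

/-- The Markov property of two walkers that follow the two components of the field. -/
lemma IsPairField.lintegral_walker_succ (h : IsPairField P q η) (h0 : 0 ≤ q) (h1 : q ≤ 1)
    (z : Site) (n : ℕ) {g : (ℤ × ℤ) × (ℤ × ℤ) → ℝ} (hg : ∀ s, 0 ≤ g s) {H : Ω → ENNReal}
    (hH : Measurable[below η (z.1.2 + n)] H) :
    ∫⁻ ω, H ω * ENNReal.ofReal (g (walker (fun u => (η u ω).1) z (n + 1),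
        walker (fun u => (η u ω).2) z (n + 1))) ∂P =
      ∫⁻ ω, H ω * ENNReal.ofReal (pairAvg q g (walker (fun u => (η u ω).1) z n,
        walker (fun u => (η u ω).2) z n)) ∂P := by
  -- The space is cut into the countably many fibres of `X`. The sites are part of the state, so on
  -- each fibre the arrows read next sit at deterministic sites, one level above everything that `H`
  -- and `X` depend on.
  set X : Ω → (Site × Site) × ((ℤ × ℤ) × (ℤ × ℤ)) := fun ω =>
    ((follow (fun u => (η u ω).1) z n, follow (fun u => (η u ω).2) z n),
      (walker (fun u => (η u ω).1) z n, walker (fun u => (η u ω).2) z n)) with hX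
  have hXm : Measurable[below η (z.1.2 + n)] X := by
    refine Measurable.prodMk (Measurable.prodMk ?_ ?_) (measurable_walker_below z n)
    · exact measurable_follow (mΩ := below η (z.1.2 + n)) fun u hu =>
        measurable_fst.comp (measurable_below hu)
    · exact measurable_follow (mΩ := below η (z.1.2 + n)) fun u hu =>
        measurable_snd.comp (measurable_below hu)
  have hmle : below η (z.1.2 + n) ≤ mΩ := h.below_le _
  have hsplit : ∀ F : Ω → ENNReal, Measurable F →
      ∫⁻ ω, F ω ∂P = ∑' σ, ∫⁻ ω, (X ⁻¹' {σ}).indicator F ω ∂P := by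
    intro F hF
    rw [← lintegral_tsum fun σ => (hF.indicator
      (hmle _ (hXm (measurableSet_singleton σ)))).aemeasurable]
    refine lintegral_congr fun ω => ?_
    rw [tsum_eq_single (X ω)]
    · simp
    · intro σ hσ
      exact Set.indicator_of_notMem (fun h => hσ (by simpa using h.symm)) _
  have hwm : ∀ k, Measurable fun ω => (walker (fun u => (η u ω).1) z k,
      walker (fun u => (η u ω).2) z k) := fun k =>
    (measurable_walker_below z k).mono (h.below_le _) le_rfl
  have hHm : Measurable H := hH.mono hmle le_rfl
  have hgm : ∀ g : (ℤ × ℤ) × (ℤ × ℤ) → ℝ, Measurable fun s => ENNReal.ofReal (g s) :=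
    fun g => measurable_of_countable _
  have hm1 : Measurable fun ω => H ω * ENNReal.ofReal (g (walker (fun u => (η u ω).1) z (n + 1),
      walker (fun u => (η u ω).2) z (n + 1))) := hHm.mul ((hgm g).comp (hwm (n + 1)))
  have hm2 : Measurable fun ω => H ω * ENNReal.ofReal (pairAvg q g
      (walker (fun u => (η u ω).1) z n, walker (fun u => (η u ω).2) z n)) :=
    hHm.mul ((hgm (pairAvg q g)).comp (hwm n))
  rw [hsplit _ hm1, hsplit _ hm2]
  refine tsum_congr fun σ => ?_
  by_cases hσ : σ ∈ Set.range X
  swap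
  · have : X ⁻¹' {σ} = ∅ := by
      rw [Set.eq_empty_iff_forall_notMem]
      exact fun ω hω => hσ ⟨ω, hω⟩
    simp [this]
  obtain ⟨ω₀, hω₀⟩ := hσ
  have hu : σ.1.1.1.2 = z.1.2 + n := by rw [← hω₀]; exact follow_level _ _ _
  have hv : σ.1.2.1.2 = z.1.2 + n := by rw [← hω₀]; exact follow_level _ _ _
  have hx : σ.2.1.1 = σ.1.1.1.1 := by rw [← hω₀]; rfl
  have hy : σ.2.2.1 = σ.1.2.1.1 := by rw [← hω₀]; rfl
  set φ : ℤˣ → ℤˣ → ℝ := fun a b => g (walkerStep σ.2.1 a, walkerStep σ.2.2 b) with hφ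
  have e1 : ∀ ω, (X ⁻¹' {σ}).indicator (fun ω => H ω * ENNReal.ofReal
      (g (walker (fun u => (η u ω).1) z (n + 1), walker (fun u => (η u ω).2) z (n + 1)))) ω =
      (X ⁻¹' {σ}).indicator H ω *
        ENNReal.ofReal (φ (η σ.1.1 ω).1 (η σ.1.2 ω).2) := by
    intro ω
    by_cases hω : ω ∈ X ⁻¹' {σ}
    · rw [Set.indicator_of_mem hω, Set.indicator_of_mem hω]
      have : X ω = σ := hω
      rw [hφ, ← this]
      rfl
    · rw [Set.indicator_of_notMem hω, Set.indicator_of_notMem hω, zero_mul]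
  have e2 : ∀ ω, (X ⁻¹' {σ}).indicator (fun ω => H ω * ENNReal.ofReal
      (pairAvg q g (walker (fun u => (η u ω).1) z n, walker (fun u => (η u ω).2) z n))) ω =
      (X ⁻¹' {σ}).indicator H ω * ENNReal.ofReal (pairAvg q g σ.2) := by
    intro ω
    by_cases hω : ω ∈ X ⁻¹' {σ}
    · rw [Set.indicator_of_mem hω, Set.indicator_of_mem hω]
      have : X ω = σ := hω
      rw [← this]
    · rw [Set.indicator_of_notMem hω, Set.indicator_of_notMem hω, zero_mul]
  have hHi : Measurable[below η (z.1.2 + n)] ((X ⁻¹' {σ}).indicator H) :=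
    hH.indicator (hXm (measurableSet_singleton σ))
  simp_rw [e1, e2]
  rw [h.lintegral_mul hu hv hHi, h.lintegral_pair h0 h1 (hu.trans hv.symm) (φ := φ)
    (fun a b => hg _), lintegral_mul_const _ (hHi.mono hmle le_rfl)]
  · rw [pairAvg, hx, hy]
  · have hpair : Measurable[MeasurableSpace.comap (η σ.1.1) inferInstance ⊔
        MeasurableSpace.comap (η σ.1.2) inferInstance] fun ω => ((η σ.1.1 ω).1, (η σ.1.2 ω).2) :=
      Measurable.prodMk
        (measurable_fst.comp ((comap_measurable (η σ.1.1)).mono le_sup_left le_rfl))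
        (measurable_snd.comp ((comap_measurable (η σ.1.2)).mono le_sup_right le_rfl))
    exact (measurable_of_countable (fun p : ℤˣ × ℤˣ => ENNReal.ofReal (φ p.1 p.2))).comp hpair

lemma IsPairField.lintegral_walker (h : IsPairField P q η) (h0 : 0 ≤ q) (h1 : q ≤ 1)
    (z : Site) (n : ℕ) {g : (ℤ × ℤ) × (ℤ × ℤ) → ℝ} (hg : ∀ s, 0 ≤ g s) {H : Ω → ENNReal}
    (hH : Measurable[below η z.1.2] H) :
    ∫⁻ ω, H ω * ENNReal.ofReal (g (walker (fun u => (η u ω).1) z n,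
        walker (fun u => (η u ω).2) z n)) ∂P =
      (∫⁻ ω, H ω ∂P) *
        ENNReal.ofReal ((pairAvg q)^[n] g ((z.1.1, z.1.1), (z.1.1, z.1.1))) := by
  induction n generalizing g with
  | zero => exact lintegral_mul_const (μ := P) (ENNReal.ofReal
      (g ((z.1.1, z.1.1), (z.1.1, z.1.1)))) (hH.mono (h.below_le _) le_rfl)
  | succ n ih =>
    rw [h.lintegral_walker_succ h0 h1 z n hg
      (hH.mono (below_mono η (by omega)) le_rfl), ih (pairAvg_nonneg h0 h1 hg)]
    rfl

/-- Independence of the walks over consecutive blocks. -/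
lemma IsPairField.lintegral_prod [IsProbabilityMeasure P] (h : IsPairField P q η) (h0 : 0 ≤ q)
    (h1 : q ≤ 1) {z : ℕ → Site} {N : ℕ → ℕ} (hz : ∀ j, (z (j + 1)).1.2 = (z j).1.2 + N j)
    {g : ℕ → (ℤ × ℤ) × (ℤ × ℤ) → ℝ} (hg : ∀ j s, 0 ≤ g j s) (J : ℕ) :
    ∫⁻ ω, ∏ j ∈ Finset.range J, ENNReal.ofReal (g j (walker (fun u => (η u ω).1) (z j) (N j),
        walker (fun u => (η u ω).2) (z j) (N j))) ∂P =
      ∏ j ∈ Finset.range J, ENNReal.ofReal ((pairAvg q)^[N j] (g j)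
        (((z j).1.1, (z j).1.1), ((z j).1.1, (z j).1.1))) := by
  have hmono : Monotone fun j => (z j).1.2 := monotone_nat_of_le_succ fun j => by
    rw [hz]; omega
  induction J with
  | zero => simp
  | succ J ih =>
    simp_rw [Finset.prod_range_succ]
    rw [h.lintegral_walker h0 h1 (z J) (N J) (hg J), ih]
    refine Finset.measurable_fun_prod _ fun j hj => ?_
    have hj' : j + 1 ≤ J := Finset.mem_range.1 hj
    have hle : below η ((z j).1.2 + N j) ≤ below η (z J).1.2 :=
      below_mono η (by rw [← hz]; exact hmono hj')
    exact (measurable_of_countable (fun s => ENNReal.ofReal (g j s))).comp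
      ((measurable_walker_below (z j) (N j)).mono hle le_rfl)

end PairField

/-! ### A single clock and its signs at two dynamical times -/

/-- Law of a waiting time and the sign drawn with it. -/
def tickLaw : Measure (ℝ × ℤˣ) := (expMeasure 1).prod (uniformOn (Set.univ : Set ℤˣ))

instance : IsProbabilityMeasure (expMeasure 1) := isProbabilityMeasure_expMeasure one_pos

instance : IsProbabilityMeasure (uniformOn (Set.univ : Set ℤˣ)) :=
  isProbabilityMeasure_uniformOn Set.finite_univ Set.univ_nonempty

instance : IsProbabilityMeasure tickLaw := by unfold tickLaw; infer_instance

/-- Law of the waiting times and signs at one site. -/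
def clockLaw : Measure (ℕ → ℝ × ℤˣ) := Measure.infinitePi fun _ => tickLaw

instance : IsProbabilityMeasure clockLaw := by unfold clockLaw; infer_instance

/-- Number of rings of a clock until `τ`. -/
def clockCount (τ : ℝ) (x : ℕ → ℝ × ℤˣ) : ℕ :=
  {n : ℕ | ∑ k ∈ Finset.range (n + 1), (x k).1 ≤ τ}.ncard

/-- Sign shown by a clock at time `τ`. -/
def clockSign (τ : ℝ) (x : ℕ → ℝ × ℤˣ) : ℤˣ := (x (clockCount τ x)).2

lemma measurable_clockCount :
    Measurable fun p : ℝ × (ℕ → ℝ × ℤˣ) => clockCount p.1 p.2 := by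
  refine measurable_ncard.comp (measurable_set_iff.2 fun n => ?_)
  have : MeasurableSet {p : ℝ × (ℕ → ℝ × ℤˣ) | ∑ k ∈ Finset.range (n + 1), (p.2 k).1 ≤ p.1} :=
    measurableSet_le (by fun_prop) (by fun_prop)
  exact measurableSet_setOfPred.1 this

lemma measurable_clockSign :
    Measurable fun p : ℝ × (ℕ → ℝ × ℤˣ) => clockSign p.1 p.2 :=
  measurable_eval_of_countable (G := fun n p => (p.2 n).2) measurable_clockCount
    fun n _ => by fun_prop

/-- Regular clocks: all waiting times are positive and they are unbounded. -/
def Regular (x : ℕ → ℝ × ℤˣ) : Prop := (∀ k, 0 < (x k).1) ∧ ∀ M : ℕ, ∃ k, (M : ℝ) < (x k).1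

lemma Regular.sum_mono {x : ℕ → ℝ × ℤˣ} (hx : Regular x) :
    Monotone fun n => ∑ k ∈ Finset.range (n + 1), (x k).1 :=
  monotone_nat_of_le_succ fun n => by
    rw [Finset.sum_range_succ _ (n + 1)]
    linarith [hx.1 (n + 1)]

/-- One waiting time longer than `τ` bounds the number of rings. Finiteness matters because
`Set.ncard` is `0` on infinite sets. -/
lemma Regular.finite {x : ℕ → ℝ × ℤˣ} (hx : Regular x) (τ : ℝ) :
    {n : ℕ | ∑ k ∈ Finset.range (n + 1), (x k).1 ≤ τ}.Finite := by
  obtain ⟨M, hM⟩ := exists_nat_ge τ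
  obtain ⟨k, hk⟩ := hx.2 M
  refine (Set.finite_lt_nat k).subset fun n hn => ?_
  by_contra! hkn
  have h1 := hx.sum_mono (not_lt.1 hkn)
  have h2 : (x k).1 ≤ ∑ i ∈ Finset.range (k + 1), (x i).1 :=
    Finset.single_le_sum (f := fun i => (x i).1) (fun i _ => (hx.1 i).le)
      (Finset.self_mem_range_succ k)
  have h3 : ∑ k ∈ Finset.range (n + 1), (x k).1 ≤ τ := hn
  simp only at h1
  linarith

lemma expMeasure_Iic (x : ℝ) (hx : 0 ≤ x) :
    expMeasure 1 (Set.Iic x) = ENNReal.ofReal (1 - Real.exp (-x)) := by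
  rw [← ofReal_cdf, cdf_expMeasure_eq one_pos, if_pos hx, one_mul]

lemma expMeasure_Ioc {s t : ℝ} (hs : 0 ≤ s) (hst : s ≤ t) :
    expMeasure 1 (Set.Ioc s t) = ENNReal.ofReal (Real.exp (-s) - Real.exp (-t)) := by
  rw [← measure_cdf (expMeasure 1), StieltjesFunction.measure_Ioc, cdf_expMeasure_eq one_pos,
    cdf_expMeasure_eq one_pos, if_pos hs, if_pos (hs.trans hst)]
  congr 1
  ring_nf

lemma tickLaw_fst (B : Set ℝ) : tickLaw (Prod.fst ⁻¹' B) = expMeasure 1 B := by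
  rw [tickLaw, ← Set.prod_univ, Measure.prod_prod, measure_univ, mul_one]

lemma clockLaw_tick (k : ℕ) {B : Set ℝ} (hB : MeasurableSet B) :
    clockLaw {x | (x k).1 ∈ B} = expMeasure 1 B := by
  rw [← tickLaw_fst, ← Measure.infinitePi_map_eval (fun _ : ℕ => tickLaw) k,
    Measure.map_apply (by fun_prop) (measurable_fst hB)]
  rfl

lemma ae_regular : ∀ᵐ x ∂clockLaw, Regular x := by
  have h1 : ∀ᵐ x ∂clockLaw, ∀ k, 0 < (x k).1 := by
    refine ae_all_iff.2 fun k => ?_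
    have := clockLaw_tick k (measurableSet_Iic (a := (0 : ℝ)))
    rw [expMeasure_Iic 0 le_rfl] at this
    rw [ae_iff]
    simpa using this
  have h2 : ∀ᵐ x ∂clockLaw, ∀ M : ℕ, ∃ k, (M : ℝ) < (x k).1 := by
    refine ae_all_iff.2 fun M => ?_
    rw [ae_iff]
    set p : ENNReal := expMeasure 1 (Set.Iic (M : ℝ)) with hp
    have hp1 : p < 1 := by
      rw [hp, expMeasure_Iic _ (Nat.cast_nonneg M)]
      exact ENNReal.ofReal_lt_one.2 (by linarith [Real.exp_pos (-(M : ℝ))])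
    -- The first `n` waiting times are independent, and each is at most `M` with probability `p <
    -- 1`.
    have hle : ∀ n : ℕ, clockLaw {x | ¬ ∃ k, (M : ℝ) < (x k).1} ≤ p ^ n := by
      intro n
      have := Measure.infinitePi_pi (fun _ : ℕ => tickLaw) (s := Finset.range n)
        (t := fun _ => Prod.fst ⁻¹' Set.Iic (M : ℝ)) (fun _ _ => measurable_fst measurableSet_Iic)
      simp only [tickLaw_fst, Finset.prod_const, Finset.card_range] at this
      rw [hp, ← this]
      refine measure_mono fun x hx => ?_
      simp only [not_exists, not_lt, Set.mem_ofPred_eq] at hx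
      exact fun k _ => hx k
    have hlim := ENNReal.tendsto_pow_atTop_nhds_zero_of_lt_one hp1
    exact le_antisymm (ge_of_tendsto' hlim hle) zero_le
  filter_upwards [h1, h2] with x hx1 hx2 using ⟨hx1, hx2⟩

/-- Away from the rings the sign is locally constant in time. -/
lemma Regular.eventually_clockSign_eq {x : ℕ → ℝ × ℤˣ} (hx : Regular x) {τ : ℝ}
    (hτ : ∀ n, ∑ k ∈ Finset.range (n + 1), (x k).1 ≠ τ) :
    ∀ᶠ τ' in nhds τ, clockSign τ' x = clockSign τ x := by
  -- Only the finitely many rings up to `τ + 1` can influence the count near `τ`.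
  have h1 : ∀ᶠ τ' in nhds τ, ∀ n ∈ {n : ℕ | ∑ k ∈ Finset.range (n + 1), (x k).1 ≤ τ + 1},
      (∑ k ∈ Finset.range (n + 1), (x k).1 ≤ τ' ↔ ∑ k ∈ Finset.range (n + 1), (x k).1 ≤ τ) := by
    rw [eventually_all_finite (hx.finite (τ + 1))]
    intro n _
    rcases lt_or_gt_of_ne (hτ n) with h | h
    · filter_upwards [lt_mem_nhds h] with τ' h'
      exact iff_of_true h'.le h.le
    · filter_upwards [gt_mem_nhds h] with τ' h'
      exact iff_of_false (not_le.2 h') (not_le.2 h)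
  filter_upwards [h1, gt_mem_nhds (lt_add_one τ)] with τ' h2 h3
  have : clockCount τ' x = clockCount τ x := by
    unfold clockCount
    congr 1
    ext n
    simp only [Set.mem_ofPred_eq] at h2 ⊢
    by_cases h4 : ∑ k ∈ Finset.range (n + 1), (x k).1 ≤ τ + 1
    · exact h2 n h4
    · constructor <;> intro h5 <;> exact absurd h5 (by linarith)
  rw [clockSign, clockSign, this]

lemma uniformOn_map_neg :
    (uniformOn (Set.univ : Set ℤˣ)).map (fun a => -a) = uniformOn (Set.univ : Set ℤˣ) := by
  refine Measure.ext_of_singleton fun a => ?_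
  have : (fun a : ℤˣ => -a) ⁻¹' {a} = {-a} := by
    ext b
    simp
  rw [Measure.map_apply (measurable_of_countable _) (measurableSet_singleton a), this,
    uniformOn_univ, uniformOn_univ, Measure.count_singleton, Measure.count_singleton]

/-- Change of the sign of a tick. -/
def negSign (y : ℝ × ℤˣ) : ℝ × ℤˣ := (y.1, -y.2)

lemma measurable_negSign : Measurable negSign :=
  measurable_fst.prodMk ((measurable_of_countable (fun a : ℤˣ => -a)).comp measurable_snd)

lemma tickLaw_map_negSign : tickLaw.map negSign = tickLaw := by
  have : negSign = Prod.map id (fun a : ℤˣ => -a) := rfl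
  rw [this, tickLaw, ← Measure.map_prod_map _ _ measurable_id (measurable_of_countable _),
    Measure.map_id, uniformOn_map_neg]

/-- Change of the signs of the ticks in `S`. -/
def flip (S : Set ℕ) [DecidablePred (· ∈ S)] (x : ℕ → ℝ × ℤˣ) (k : ℕ) : ℝ × ℤˣ :=
  if k ∈ S then negSign (x k) else x k

lemma measurePreserving_flip (S : Set ℕ) [DecidablePred (· ∈ S)] :
    MeasurePreserving (flip S) clockLaw clockLaw := by
  have hm : ∀ k, Measurable fun y : ℝ × ℤˣ => if k ∈ S then negSign y else y := by
    intro k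
    by_cases h : k ∈ S
    · simpa [h] using measurable_negSign
    · simp only [h, if_false]
      exact measurable_id
  refine ⟨measurable_pi_iff.2 fun k => (hm k).comp (measurable_pi_apply k), ?_⟩
  have := Measure.infinitePi_map_pi (fun _ : ℕ => tickLaw)
    (f := fun k y => if k ∈ S then negSign y else y) hm
  rw [clockLaw]
  refine Eq.trans this ?_
  congr 1
  funext k
  by_cases h : k ∈ S
  · simpa [h] using tickLaw_map_negSign
  · simp [h]

lemma flip_fst (S : Set ℕ) [DecidablePred (· ∈ S)] (x : ℕ → ℝ × ℤˣ) (k : ℕ) :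
    (flip S x k).1 = (x k).1 := by
  unfold flip negSign; split_ifs <;> rfl

lemma clockCount_flip (S : Set ℕ) [DecidablePred (· ∈ S)] (τ : ℝ) (x : ℕ → ℝ × ℤˣ) :
    clockCount τ (flip S x) = clockCount τ x := by
  simp only [clockCount, flip_fst]

/-- Probability that a clock shows different signs at two times. -/
def flipProb (s t : ℝ) : ℝ := clockLaw.real {x | clockSign s x ≠ clockSign t x}

lemma flipProb_nonneg (s t : ℝ) : 0 ≤ flipProb s t := measureReal_nonneg

lemma flipProb_le_one (s t : ℝ) : flipProb s t ≤ 1 := measureReal_le_one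

lemma flipProb_comm (s t : ℝ) : flipProb s t = flipProb t s := by
  simp only [flipProb, ne_comm]

lemma measurable_clockSign_left (τ : ℝ) : Measurable (clockSign τ) :=
  measurable_clockSign.comp (measurable_prodMk_left (x := τ))

lemma measurable_clockCount_left (τ : ℝ) : Measurable (clockCount τ) := by
  have := measurable_clockCount.comp (measurable_prodMk_left (x := τ))
  simpa only [Function.comp_def] using this

/-- Negating all signs preserves the law and the ring times, so the joint law is symmetric under
negation and determined by the probability of disagreement. -/
lemma clockLaw_pair (s t : ℝ) (a b : ℤˣ) :
    clockLaw {x | (clockSign s x, clockSign t x) = (a, b)} =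
      ENNReal.ofReal (coinWeight (flipProb s t) a b) := by
  set p : ℤˣ → ℤˣ → ℝ := fun a b => clockLaw.real {x | (clockSign s x, clockSign t x) = (a, b)}
    with hp
  have hms : ∀ a b, MeasurableSet {x | (clockSign s x, clockSign t x) = (a, b)} := fun a b =>
    ((measurable_clockSign_left s).prodMk (measurable_clockSign_left t))
      (measurableSet_singleton (a, b))
  have hsymm : ∀ a b, p a b = p (-a) (-b) := by
    intro a b
    have := (measurePreserving_flip Set.univ).measureReal_preimage (hms a b).nullMeasurableSet
    simp only [hp]
    rw [← this]
    congr 1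
    ext x
    have hsign : ∀ τ, clockSign τ (flip Set.univ x) = -clockSign τ x := fun τ => by
      simp [clockSign, clockCount_flip, flip, negSign]
    simp only [Set.mem_preimage, Set.mem_ofPred_eq, Prod.mk.injEq, hsign, neg_eq_iff_eq_neg]
  have hne : (1 : ℤˣ) ≠ -1 := by decide
  have hne' : (-1 : ℤˣ) ≠ 1 := by decide
  have hq : flipProb s t = p 1 (-1) + p (-1) 1 := by
    have e : {x | clockSign s x ≠ clockSign t x} =
        {x | (clockSign s x, clockSign t x) = (1, -1)} ∪
          {x | (clockSign s x, clockSign t x) = (-1, 1)} := by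
      ext x
      rcases Int.units_eq_one_or (clockSign s x) with h | h <;>
        rcases Int.units_eq_one_or (clockSign t x) with h' | h' <;> simp [h, h', hne, hne']
    rw [flipProb, e, measureReal_union _ (hms _ _)]
    rw [Set.disjoint_left]
    intro x h1 h2
    have : ((1, -1) : ℤˣ × ℤˣ) = (-1, 1) := h1.symm.trans h2
    exact absurd this (by decide)
  have hq' : 1 - flipProb s t = p 1 1 + p (-1) (-1) := by
    have e : {x | clockSign s x ≠ clockSign t x}ᶜ =
        {x | (clockSign s x, clockSign t x) = (1, 1)} ∪
          {x | (clockSign s x, clockSign t x) = (-1, -1)} := by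
      ext x
      rcases Int.units_eq_one_or (clockSign s x) with h | h <;>
        rcases Int.units_eq_one_or (clockSign t x) with h' | h' <;> simp [h, h', hne, hne']
    rw [flipProb, ← probReal_compl_eq_one_sub, e, measureReal_union _ (hms _ _)]
    · rw [Set.disjoint_left]
      intro x h1 h2
      have : ((1, 1) : ℤˣ × ℤˣ) = (-1, -1) := h1.symm.trans h2
      exact absurd this (by decide)
    · exact (measurableSet_eq_fun (measurable_clockSign_left s)
        (measurable_clockSign_left t)).compl
  have e1 := hsymm 1 1
  have e2 := hsymm 1 (-1)
  rw [neg_neg] at e2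
  obtain ⟨c1, c2, c3, c4⟩ := coinWeight_values (flipProb s t)
  rw [← ofReal_measureReal]
  congr 1
  change p a b = _
  rcases Int.units_eq_one_or a with rfl | rfl <;> rcases Int.units_eq_one_or b with rfl | rfl
  · rw [c1]; linarith
  · rw [c2]; linarith
  · rw [c3]; linarith
  · rw [c4]; linarith

/-- If there is no ring until `s` but one by `t`, the sign at `s` is the initial one and the sign at
`t` a later one. Negating only the initial sign preserves the law and exchanges agreement with
disagreement, so half of this event counts. -/
lemma le_flipProb_of_lt {s t : ℝ} (hs : 0 ≤ s) (hst : s < t) (ht : t ≤ 1) :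
    Real.exp (-1) / 2 * (t - s) ≤ flipProb s t := by
  set B : Set (ℕ → ℝ × ℤˣ) := {x | clockCount s x = 0 ∧ clockCount t x ≠ 0} with hB
  have hBm : MeasurableSet B :=
    (measurable_clockCount_left s (measurableSet_singleton 0)).inter
      (measurable_clockCount_left t (measurableSet_singleton 0)).compl
  set N : Set (ℕ → ℝ × ℤˣ) := {x | clockSign s x ≠ clockSign t x} with hN
  have hNm : MeasurableSet N :=
    (measurableSet_eq_fun (measurable_clockSign_left s) (measurable_clockSign_left t)).compl
  have hflip : clockLaw.real (B ∩ N) = clockLaw.real (B \ N) := by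
    have := (measurePreserving_flip {0}).measureReal_preimage (hBm.inter hNm).nullMeasurableSet
    rw [← this]
    congr 1
    ext x
    simp only [hB, hN, Set.mem_preimage, Set.mem_inter_iff, Set.mem_ofPred_eq, clockCount_flip,
      Set.mem_sdiff, not_not]
    refine and_congr_right fun ⟨h1, h2⟩ => ?_
    simp only [clockSign, clockCount_flip, h1, flip, negSign, Set.mem_singleton_iff, h2, if_true,
      if_false]
    rcases Int.units_eq_one_or (x 0).2 with h | h <;>
      rcases Int.units_eq_one_or (x (clockCount t x)).2 with h' | h' <;> rw [h, h'] <;> decide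
  have hsum : clockLaw.real (B ∩ N) + clockLaw.real (B \ N) = clockLaw.real B :=
    measureReal_inter_add_sdiff hNm
  have hBge : Real.exp (-1) * (t - s) ≤ clockLaw.real B := by
    have h1 : clockLaw {x | (x 0).1 ∈ Set.Ioc s t} ≤ clockLaw B := by
      refine measure_mono_ae ?_
      filter_upwards [ae_regular] with x hx hx0
      have hx0' : s < (x 0).1 ∧ (x 0).1 ≤ t := hx0
      refine ⟨?_, ?_⟩
      · rw [clockCount, Set.ncard_eq_zero (hx.finite s), Set.eq_empty_iff_forall_notMem]
        intro n hn
        have h2 := hx.sum_mono (Nat.zero_le n)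
        have h3 : ∑ k ∈ Finset.range (n + 1), (x k).1 ≤ s := hn
        simp only [zero_add, Finset.sum_range_one] at h2
        linarith
      · rw [clockCount, Ne, Set.ncard_eq_zero (hx.finite t), ← Ne, ← Set.nonempty_iff_ne_empty]
        exact ⟨0, by simpa using hx0'.2⟩
    rw [clockLaw_tick 0 measurableSet_Ioc, expMeasure_Ioc hs hst.le] at h1
    have h2 : Real.exp (-s) - Real.exp (-t) ≤ clockLaw.real B := by
      have := ENNReal.toReal_mono (measure_ne_top _ _) h1
      rwa [ENNReal.toReal_ofReal (by
        have : Real.exp (-t) ≤ Real.exp (-s) := Real.exp_le_exp.2 (by linarith)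
        linarith)] at this
    refine le_trans ?_ h2
    have h3 : Real.exp (-s) = Real.exp (-t) * Real.exp (t - s) := by
      rw [← Real.exp_add]; congr 1; ring
    have h4 : t - s + 1 ≤ Real.exp (t - s) := Real.add_one_le_exp _
    have h5 : Real.exp (-1) ≤ Real.exp (-t) := Real.exp_le_exp.2 (by linarith)
    have h6 : 0 < Real.exp (-t) := Real.exp_pos _
    rw [h3]
    nlinarith
  have hle : clockLaw.real (B ∩ N) ≤ flipProb s t := measureReal_mono Set.inter_subset_right
  linarith

lemma le_flipProb {s t : ℝ} (hs : s ∈ Set.Icc (0 : ℝ) 1) (ht : t ∈ Set.Icc (0 : ℝ) 1) :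
    Real.exp (-1) / 2 * |s - t| ≤ flipProb s t := by
  rcases lt_trichotomy s t with h | h | h
  · rw [abs_sub_comm, abs_of_pos (by linarith)]
    exact le_flipProb_of_lt hs.1 h ht.2
  · rw [h, sub_self, abs_zero, mul_zero]
    exact flipProb_nonneg _ _
  · rw [abs_of_pos (by linarith), flipProb_comm]
    exact le_flipProb_of_lt ht.1 h hs.2

/-! ### Noncrossing, blocks and subdiffusivity -/

lemma follow_add (ξ : Site → ℤˣ) (z : Site) (m n : ℕ) :
    follow ξ z (m + n) = follow ξ (follow ξ z m) n := by
  induction n with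
  | zero => rfl
  | succ n ih => rw [← add_assoc, follow, follow, ih]

/-- Walks that follow the same arrows do not cross. -/
lemma follow_mono (ξ : Site → ℤˣ) {u v : Site} (hl : u.1.2 = v.1.2) (hx : u.1.1 ≤ v.1.1) (n : ℕ) :
    (follow ξ u n).1.1 ≤ (follow ξ v n).1.1 := by
  induction n with
  | zero => exact hx
  | succ n ih =>
    have hl' : (follow ξ u n).1.2 = (follow ξ v n).1.2 := by rw [follow_level, follow_level, hl]
    rcases ih.eq_or_lt with h | h
    · rw [follow, follow, site_ext h hl']
    -- Both sites lie in the even lattice on the same level, so distinct positions differ by at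
    -- least `2` and one step cannot make them cross.
    · obtain ⟨i, hi⟩ := (follow ξ u n).2
      obtain ⟨j, hj⟩ := (follow ξ v n).2
      have h1 := Int.units_eq_one_or (ξ (follow ξ u n))
      have h2 := Int.units_eq_one_or (ξ (follow ξ v n))
      simp only [follow, Site.next]
      rcases h1 with h1 | h1 <;> rcases h2 with h2 | h2 <;>
        simp only [h1, h2, Units.val_one, Units.val_neg] <;> omega

lemma follow_le_record (ξ : Site → ℤˣ) (z : Site) {k n : ℕ} (h : k ≤ n) :
    (follow ξ z k).1.1 ≤ record ξ z n := by
  induction n, h using Nat.le_induction with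
  | base =>
    cases k with
    | zero => exact le_rfl
    | succ k => exact le_max_right _ _
  | succ n _ ih => exact ih.trans (le_max_left _ _)

/-- Height allowed for the block `j`. -/
def blockHeight (K k₀ j : ℕ) : ℕ := K * 2 ^ (k₀ + j + 1)

/-- Duration of the block `j`. -/
def blockTime (k₀ j : ℕ) : ℕ := 4 ^ (k₀ + j + 1)

/-- Starting point of the block `j`. -/
def blockStart (K k₀ : ℕ) : ℕ → Site
  | 0 => origin
  | j + 1 => ⟨((blockStart K k₀ j).1.1 + blockHeight K k₀ j,
      (blockStart K k₀ j).1.2 + blockTime k₀ j), by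
        -- The `+ 1` in the exponents makes heights and durations even for every `k₀` and `j`, so
        -- the starting points stay in the lattice.
        have h1 : Even ((blockHeight K k₀ j : ℕ) : ℤ) := by
          rw [Int.even_coe_nat, blockHeight, pow_succ]
          exact (even_two.mul_left _).mul_left _
        have h2 : Even ((blockTime k₀ j : ℕ) : ℤ) := by
          rw [Int.even_coe_nat, blockTime, pow_succ]
          exact (by decide : Even 4).mul_left _
        obtain ⟨a, ha⟩ := (blockStart K k₀ j).2
        obtain ⟨b, hb⟩ := h1
        obtain ⟨c, hc⟩ := h2
        exact ⟨a + b + c, by simp only [hb, hc]; omega⟩⟩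

/-- Walk time at which the block `j` starts. -/
def blockBegin (k₀ j : ℕ) : ℕ := ∑ i ∈ Finset.range j, blockTime k₀ i

lemma blockStart_level (K k₀ j : ℕ) : (blockStart K k₀ j).1.2 = blockBegin k₀ j := by
  induction j with
  | zero => rfl
  | succ j ih =>
    rw [blockBegin, Finset.sum_range_succ, ← blockBegin]
    push_cast
    rw [← ih]
    rfl

lemma blockStart_height (K k₀ j : ℕ) :
    (blockStart K k₀ j).1.1 + K * 2 ^ (k₀ + 1) = K * 2 ^ (k₀ + j + 1) := by
  induction j with
  | zero => simp [blockStart, origin]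
  | succ j ih =>
    have : (blockStart K k₀ (j + 1)).1.1 = (blockStart K k₀ j).1.1 + blockHeight K k₀ j := rfl
    rw [this, blockHeight]
    push_cast
    rw [show k₀ + (j + 1) + 1 = (k₀ + j + 1) + 1 by ring, pow_succ (2 : ℤ) (k₀ + j + 1)]
    linarith

/-- The cutoff of the walk over the block `j`. -/
def blockBump (K k₀ : ℕ) (ξ : Site → ℤˣ) (j : ℕ) : ℝ :=
  bump (blockStart K k₀ j).1.1 (blockHeight K k₀ j) (walker ξ (blockStart K k₀ j) (blockTime k₀ j))

lemma blockHeight_pos {K : ℕ} (hK : 0 < K) (k₀ j : ℕ) : (0 : ℝ) < blockHeight K k₀ j := by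
  unfold blockHeight; positivity

/-- At the start of each block the walk from the origin lies weakly left of the block's own walk; by
noncrossing it remains so, and a positive cutoff keeps that walk below the next starting height. -/
lemma follow_le_of_blockBump_pos {K : ℕ} (hK : 0 < K) (k₀ : ℕ) {ξ : Site → ℤˣ}
    (h : ∀ j, 0 < blockBump K k₀ ξ j) (j : ℕ) :
    (follow ξ origin (blockBegin k₀ j)).1.1 ≤ (blockStart K k₀ j).1.1 ∧
      ∀ n ≤ blockTime k₀ j, (follow ξ origin (blockBegin k₀ j + n)).1.1 ≤
        (blockStart K k₀ (j + 1)).1.1 := by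
  have step : ∀ j, (follow ξ origin (blockBegin k₀ j)).1.1 ≤ (blockStart K k₀ j).1.1 →
      ∀ n ≤ blockTime k₀ j, (follow ξ origin (blockBegin k₀ j + n)).1.1 ≤
        (blockStart K k₀ (j + 1)).1.1 := by
    intro j hj n hn
    rw [follow_add]
    have hl : (follow ξ origin (blockBegin k₀ j)).1.2 = (blockStart K k₀ j).1.2 := by
      rw [follow_level, blockStart_level]; simp [origin]
    refine (follow_mono ξ hl hj n).trans ((follow_le_record ξ _ hn).trans ?_)
    have h1 := lt_of_bump_pos (blockHeight_pos hK k₀ j) (h j)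
    have h2 : record ξ (blockStart K k₀ j) (blockTime k₀ j) <
        (blockStart K k₀ j).1.1 + (blockHeight K k₀ j : ℤ) := by exact_mod_cast h1
    exact h2.le
  have start : (follow ξ origin (blockBegin k₀ j)).1.1 ≤ (blockStart K k₀ j).1.1 := by
    induction j with
    | zero => exact le_rfl
    | succ j ih =>
      have := step j ih _ le_rfl
      rwa [blockBegin, Finset.sum_range_succ, ← blockBegin]
  exact ⟨start, step j start⟩

/-- In block `j ≥ 1` the height is at most `K * 2 ^ (k₀ + j + 2)`, while the elapsed time is at
least the duration `4 ^ (k₀ + j)` of the preceding block; hence the factor `4`. Block `0` has no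
predecessor and is excluded. -/
lemma follow_le_sqrt {K : ℕ} (hK : 0 < K) (k₀ : ℕ) {ξ : Site → ℤˣ}
    (h : ∀ j, 0 < blockBump K k₀ ξ j) {n : ℕ} (hn : blockBegin k₀ 1 ≤ n) :
    ((follow ξ origin n).1.1 : ℝ) ≤ 4 * K * √n := by
  have key : ∀ j, 1 ≤ j → ∀ n, blockBegin k₀ 1 ≤ n → n ≤ blockBegin k₀ j →
      ((follow ξ origin n).1.1 : ℝ) ≤ 4 * K * √n := by
    have hblock : ∀ j, 1 ≤ j → ∀ n, blockBegin k₀ j ≤ n → n ≤ blockBegin k₀ (j + 1) →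
        ((follow ξ origin n).1.1 : ℝ) ≤ 4 * K * √n := by
      intro j hj n h1 h2
      obtain ⟨m, rfl⟩ := Nat.exists_eq_add_of_le h1
      have hm : m ≤ blockTime k₀ j := by
        rw [blockBegin, blockBegin, Finset.sum_range_succ] at h2
        omega
      have h3 := (follow_le_of_blockBump_pos hK k₀ h j).2 m hm
      have h4 := blockStart_height K k₀ (j + 1)
      have h5 : (blockStart K k₀ (j + 1)).1.1 ≤ K * 2 ^ (k₀ + (j + 1) + 1) := by
        rw [← h4]
        have : (0 : ℤ) ≤ K * 2 ^ (k₀ + 1) := by positivity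
        linarith
      have h6 : ((follow ξ origin (blockBegin k₀ j + m)).1.1 : ℝ) ≤ K * 2 ^ (k₀ + (j + 1) + 1) := by
        exact_mod_cast h3.trans h5
      have h7 : (2 : ℝ) ^ (k₀ + j) ≤ √((blockBegin k₀ j + m : ℕ) : ℝ) := by
        refine Real.le_sqrt_of_sq_le ?_
        have h8 : 4 ^ (k₀ + j) ≤ blockBegin k₀ j := by
          obtain ⟨i, rfl⟩ := Nat.exists_eq_add_of_le' hj
          rw [blockBegin, Finset.sum_range_succ, blockTime, ← add_assoc]
          exact Nat.le_add_left _ _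
        have h9 : ((4 ^ (k₀ + j) : ℕ) : ℝ) ≤ ((blockBegin k₀ j + m : ℕ) : ℝ) := by
          exact_mod_cast h8.trans (Nat.le_add_right _ _)
        refine le_trans (le_of_eq ?_) h9
        push_cast
        rw [← pow_mul, mul_comm, pow_mul]
        norm_num
      calc _ ≤ (K : ℝ) * 2 ^ (k₀ + (j + 1) + 1) := h6
        _ = 4 * K * 2 ^ (k₀ + j) := by ring
        _ ≤ _ := by gcongr
    intro j hj
    induction j, hj using Nat.le_induction with
    | base =>
      intro n h1 h2
      have h3 : blockBegin k₀ 1 ≤ blockBegin k₀ (1 + 1) := by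
        rw [blockBegin, blockBegin, Finset.sum_range_succ _ 1]; omega
      exact hblock 1 le_rfl n h1 (h2.trans h3)
    | succ j hj ih =>
      intro n h1 h2
      rcases le_total n (blockBegin k₀ j) with h3 | h3
      · exact ih n h1 h3
      · exact hblock j hj n h3 h2
  have hgrow : ∀ j, j ≤ blockBegin k₀ j := by
    intro j
    calc j = ∑ i ∈ Finset.range j, 1 := by simp
      _ ≤ _ := Finset.sum_le_sum fun i _ => Nat.one_le_pow _ _ (by norm_num)
  have hn1 : 1 ≤ n := (hgrow 1).trans hn
  exact key n hn1 n hn (hgrow n)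

/-- A walk that passes all cutoffs is subdiffusive. -/
lemma subdiffusive_of_blockBump_pos {K : ℕ} (hK : 0 < K) (k₀ : ℕ) {ξ : Site → ℤˣ}
    (h : ∀ j, 0 < blockBump K k₀ ξ j) : Subdiffusive fun n => (follow ξ origin n).1.1 := by
  refine ⟨4 * K, by positivity, Or.inr ?_⟩
  refine limsup_le_of_le (by isBoundedDefault) ?_
  filter_upwards [eventually_ge_atTop (blockBegin k₀ 1), eventually_gt_atTop 0] with n hn hn0
  have h1 : 0 < √(n : ℝ) := Real.sqrt_pos.2 (by exact_mod_cast hn0)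
  rw [EReal.coe_le_coe_iff, div_le_iff₀ h1]
  exact follow_le_sqrt hK k₀ h hn

/-- The LIL normalization exceeds `√n` by the unbounded factor `√(2 log log n)`. Any constant below
`1` would do in place of `1 / 2`. -/
lemma eventually_div_le_half {f : ℕ → ℝ} {C : ℝ} (h : ∀ᶠ n in atTop, f n / √(n : ℝ) ≤ C) :
    ∀ᶠ n : ℕ in atTop, f n / √(2 * (n : ℝ) * Real.log (Real.log n)) ≤ 1 / 2 := by
  have hlim : Tendsto (fun n : ℕ => √(2 * Real.log (Real.log (n : ℝ)))) atTop atTop :=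
    Real.tendsto_sqrt_atTop.comp ((Real.tendsto_log_atTop.comp (Real.tendsto_log_atTop.comp
      tendsto_natCast_atTop_atTop)).const_mul_atTop two_pos)
  filter_upwards [h, hlim.eventually_ge_atTop (2 * |C| + 1)] with n h1 h2
  have hpos : 0 < √(2 * Real.log (Real.log (n : ℝ))) := by
    have := abs_nonneg C; linarith
  rw [show 2 * (n : ℝ) * Real.log (Real.log n) = n * (2 * Real.log (Real.log n)) by ring,
    Real.sqrt_mul (Nat.cast_nonneg n), ← div_div, div_le_iff₀ hpos]
  linarith [le_abs_self C]

/-- A subdiffusive path does not obey the law of the iterated logarithm. -/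
lemma Subdiffusive.not_obeysLIL {π : ℕ → ℤ} (h : Subdiffusive π) : ¬ ObeysLIL π := by
  obtain ⟨K, hK, h | h⟩ := h
  · rintro ⟨-, hinf⟩
    have h1 : ((-K - 1 : ℝ) : EReal) <
        liminf (fun n : ℕ => (((π n : ℝ) / √(n : ℝ) : ℝ) : EReal)) atTop :=
      lt_of_lt_of_le (EReal.coe_lt_coe_iff.2 (by linarith)) h
    have h2 := eventually_lt_of_lt_liminf h1 (by isBoundedDefault)
    have h3 := eventually_div_le_half (f := fun n => -(π n : ℝ)) (C := K + 1) (by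
      filter_upwards [h2] with n hn
      rw [EReal.coe_lt_coe_iff] at hn
      rw [neg_div]
      linarith)
    have h4 : ((-(1 / 2) : ℝ) : EReal) ≤ liminf (lilRatio π) atTop := by
      refine le_liminf_of_le (by isBoundedDefault) ?_
      filter_upwards [h3] with n hn
      rw [lilRatio, EReal.coe_le_coe_iff]
      rw [neg_div] at hn
      linarith
    rw [hinf] at h4
    have h5 : ((-(1 / 2) : ℝ) : EReal) ≤ ((-1 : ℝ) : EReal) := by simpa using h4
    rw [EReal.coe_le_coe_iff] at h5
    linarith
  · rintro ⟨hsup, -⟩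
    have h1 : limsup (fun n : ℕ => (((π n : ℝ) / √(n : ℝ) : ℝ) : EReal)) atTop <
        ((K + 1 : ℝ) : EReal) :=
      lt_of_le_of_lt h (EReal.coe_lt_coe_iff.2 (by linarith))
    have h2 := eventually_lt_of_limsup_lt h1 (by isBoundedDefault)
    have h3 := eventually_div_le_half (f := fun n => (π n : ℝ)) (C := K + 1) (by
      filter_upwards [h2] with n hn
      rw [EReal.coe_lt_coe_iff] at hn
      exact hn.le)
    have h4 : limsup (lilRatio π) atTop ≤ ((1 / 2 : ℝ) : EReal) := by
      refine limsup_le_of_le (by isBoundedDefault) ?_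
      filter_upwards [h3] with n hn
      rwa [lilRatio, EReal.coe_le_coe_iff]
    rw [hsup] at h4
    have h5 : ((1 : ℝ) : EReal) ≤ ((1 / 2 : ℝ) : EReal) := by simpa using h4
    rw [EReal.coe_le_coe_iff] at h5
    linarith

/-! ### The system of all clocks and the block estimates -/

/-- The arrows at dynamical time `τ` as a function of all clocks. -/
def arrows (τ : ℝ) (ω : Site → ℕ → ℝ × ℤˣ) (z : Site) : ℤˣ := clockSign τ (ω z)

/-- A walk of `n` steps reads finitely many arrows, each locally constant in time away from the
rings. -/
lemma eventually_walker_eq {ω : Site → ℕ → ℝ × ℤˣ} (hω : ∀ z, Regular (ω z)) {τ : ℝ}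
    (hτ : ∀ z n, ∑ k ∈ Finset.range (n + 1), (ω z k).1 ≠ τ) (z : Site) (n : ℕ) :
    ∀ᶠ τ' in nhds τ, walker (arrows τ' ω) z n = walker (arrows τ ω) z n := by
  have hf : ∀ n, ∀ᶠ τ' in nhds τ, follow (arrows τ' ω) z n = follow (arrows τ ω) z n := by
    intro n
    induction n with
    | zero => exact Eventually.of_forall fun _ => rfl
    | succ n ih =>
      filter_upwards [ih, (hω (follow (arrows τ ω) z n)).eventually_clockSign_eq
        (hτ (follow (arrows τ ω) z n))] with τ' h1 h2
      rw [follow, follow, h1]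
      exact congrArg _ h2
  have hr : ∀ᶠ τ' in nhds τ, record (arrows τ' ω) z n = record (arrows τ ω) z n := by
    induction n with
    | zero => exact Eventually.of_forall fun _ => rfl
    | succ n ih =>
      filter_upwards [ih, hf (n + 1)] with τ' h1 h2
      rw [record, record, h1, h2]
  filter_upwards [hf n, hr] with τ' h1 h2
  rw [walker, walker, h1, h2]

/-- Law of all clocks. -/
def systemLaw : Measure (Site → ℕ → ℝ × ℤˣ) := Measure.infinitePi fun _ => clockLaw

instance : IsProbabilityMeasure systemLaw := by unfold systemLaw; infer_instance

lemma isPairField_arrows (s t : ℝ) : IsPairField systemLaw (flipProb s t)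
    fun z ω => (arrows s ω z, arrows t ω z) := by
  have hm : Measurable fun x => (clockSign s x, clockSign t x) :=
    (measurable_clockSign_left s).prodMk (measurable_clockSign_left t)
  refine ⟨fun z => hm.comp (measurable_pi_apply z), ?_, fun z a b => ?_⟩
  · exact iIndepFun_infinitePi (P := fun _ : Site => clockLaw)
      (X := fun _ x => (clockSign s x, clockSign t x)) fun _ => hm
  · rw [← clockLaw_pair]
    have := (measurePreserving_eval_infinitePi (fun _ : Site => clockLaw) z).measure_preimage
      (hm (measurableSet_singleton (a, b))).nullMeasurableSet
    exact this

/-- Expected cutoff over a block. -/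
def blockMean (K k₀ j : ℕ) : ℝ :=
  soloAvg^[blockTime k₀ j] (bump (blockStart K k₀ j).1.1 (blockHeight K k₀ j))
    ((blockStart K k₀ j).1.1, (blockStart K k₀ j).1.1)

/-- Expected product of the cutoffs over a block at two times. -/
def blockPairMean (q : ℝ) (K k₀ j : ℕ) : ℝ :=
  (pairAvg q)^[blockTime k₀ j] (fun s => bump (blockStart K k₀ j).1.1 (blockHeight K k₀ j) s.1 *
      bump (blockStart K k₀ j).1.1 (blockHeight K k₀ j) s.2)
    (((blockStart K k₀ j).1.1, (blockStart K k₀ j).1.1),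
      ((blockStart K k₀ j).1.1, (blockStart K k₀ j).1.1))

lemma blockTime_cast (k₀ j : ℕ) : (blockTime k₀ j : ℝ) = ((2 : ℝ) ^ (k₀ + j + 1)) ^ 2 := by
  rw [blockTime]
  push_cast
  rw [← pow_mul, mul_comm, pow_mul]
  norm_num

lemma le_blockMean {K : ℕ} (hK : 0 < K) (k₀ j : ℕ) : 1 - 2 / (K : ℝ) ≤ blockMean K k₀ j := by
  have h := le_soloAvg_iterate_bump (r := 2 ^ (k₀ + j + 1)) (by positivity)
    (blockHeight_pos hK k₀ j) (blockTime_cast k₀ j) (blockStart K k₀ j).1.1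
  refine le_trans (le_of_eq ?_) h
  have : (K : ℝ) ≠ 0 := by positivity
  rw [blockHeight]
  push_cast
  field_simp

lemma blockPairMean_nonneg {q : ℝ} (h0 : 0 ≤ q) (h1 : q ≤ 1) (K k₀ j : ℕ) :
    0 ≤ blockPairMean q K k₀ j :=
  pairAvg_iterate_nonneg h0 h1 _ (fun _ => mul_nonneg (bump_nonneg _ _ _) (bump_nonneg _ _ _)) _

lemma blockPairMean_le_blockMean {q : ℝ} (h0 : 0 ≤ q) (h1 : q ≤ 1) (K k₀ j : ℕ) :
    blockPairMean q K k₀ j ≤ blockMean K k₀ j := by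
  refine (pairAvg_iterate_mono h0 h1 _ (fun s => mul_le_of_le_one_right (bump_nonneg _ _ s.1)
    (bump_le_one _ _ _)) _).trans (le_of_eq ?_)
  exact pairAvg_iterate_fst q _ _ _

/-- With `r = 2 ^ (k₀ + j + 1)` the error `√(8 * r / q) / (K * r)` is at most `1 / √(q * r)`, since
`8 ≤ K ^ 2`. Writing `q * r = 2 ^ j * v` gives the form of `exists_prod_le_one_add_rpow`. -/
lemma blockPairMean_le {q : ℝ} (h0 : 0 < q) (h1 : q ≤ 1) {K : ℕ} (hK : 4 ≤ K) (k₀ j : ℕ) :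
    blockPairMean q K k₀ j ≤ blockMean K k₀ j ^ 2 + 1 / √(2 ^ j * (q * 2 ^ (k₀ + 1))) := by
  have hK0 : 0 < K := by omega
  have hr : (0 : ℝ) < 2 ^ (k₀ + j + 1) := by positivity
  refine (pairAvg_iterate_bump_le h0 h1 hr (blockHeight_pos hK0 k₀ j) (blockTime_cast k₀ j)
    (blockStart K k₀ j).1.1).trans ?_
  refine add_le_add le_rfl ?_
  set r : ℝ := 2 ^ (k₀ + j + 1) with hrdef
  have e1 : (2 : ℝ) ^ j * (q * 2 ^ (k₀ + 1)) = q * r := by rw [hrdef]; ring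
  have e2 : (blockHeight K k₀ j : ℝ) = K * r := by rw [blockHeight, hrdef]; push_cast; rfl
  have hqr : 0 < √(q * r) := Real.sqrt_pos.2 (by positivity)
  have hKr : (0 : ℝ) < K * r := by positivity
  rw [e1, e2, div_le_div_iff₀ hKr hqr, ← Real.sqrt_mul (by positivity), one_mul]
  have e3 : 8 * r / q * (q * r) = 8 * r ^ 2 := by field_simp
  rw [e3]
  refine Real.sqrt_le_iff.2 ⟨hKr.le, ?_⟩
  have hK4 : (4 : ℝ) ≤ K := by exact_mod_cast hK
  rw [mul_pow]
  gcongr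
  nlinarith

/-- The product estimate applies to the ratios `blockPairMean / blockMean ^ 2`. Dropping one cutoff
bounds them by `(1 - 2 / K)⁻¹`, and `K` is chosen to make this at most `2 ^ (b / 2)`. The constant
`4` is the inverse of the lower bound `1 / 4` for `blockMean ^ 2`. -/
lemma exists_prod_blockPairMean_le {b : ℝ} (hb : 0 < b) (hb' : b ≤ 1 / 2) :
    ∃ K : ℕ, 4 ≤ K ∧ ∃ A : ℝ, 0 < A ∧ ∀ (k₀ J : ℕ) (q : ℝ), 0 < q → q ≤ 1 →
      ∏ j ∈ Finset.range J, blockPairMean q K k₀ j ≤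
        (∏ j ∈ Finset.range J, blockMean K k₀ j ^ 2) * (1 + A * (q * 2 ^ (k₀ + 1)) ^ (-b)) := by
  obtain ⟨A, hA, hprod⟩ := exists_prod_le_one_add_rpow hb hb' (C := 4) (by norm_num)
  have hβ1 : (1 : ℝ) < 2 ^ (b / 2) := Real.one_lt_rpow one_lt_two (by linarith)
  have hlim : Tendsto (fun K : ℕ => (1 - 2 / (K : ℝ))⁻¹) atTop (nhds 1) := by
    have : Tendsto (fun K : ℕ => (1 - 2 / (K : ℝ))) atTop (nhds (1 - 0)) :=
      tendsto_const_nhds.sub (tendsto_const_div_atTop_nhds_zero_nat 2)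
    simpa using this.inv₀ (by norm_num)
  obtain ⟨K, hK, hKβ⟩ := ((eventually_ge_atTop 4).and (hlim.eventually_le_const hβ1)).exists
  refine ⟨K, hK, A, hA, fun k₀ J q h0 h1 => ?_⟩
  have hK4 : (4 : ℝ) ≤ K := by exact_mod_cast hK
  have hhalf : 2 / (K : ℝ) ≤ 1 / 2 := by
    rw [div_le_div_iff₀ (by linarith) two_pos]; linarith
  have he : ∀ j, 1 - 2 / (K : ℝ) ≤ blockMean K k₀ j := le_blockMean (by omega) k₀
  have he0 : ∀ j, 0 < blockMean K k₀ j := fun j => by linarith [he j]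
  have hmain := hprod (1 - 2 / (K : ℝ))⁻¹
    ((one_le_inv₀ (by linarith)).2 (by linarith [show 0 ≤ 2 / (K : ℝ) by positivity])) hKβ J
    (q * 2 ^ (k₀ + 1)) (fun j => blockPairMean q K k₀ j / blockMean K k₀ j ^ 2) (by positivity)
    (fun j => div_nonneg (blockPairMean_nonneg h0.le h1 K k₀ j) (by positivity))
    (fun j => by
      have h2 := blockPairMean_le_blockMean h0.le h1 K k₀ j
      calc _ ≤ blockMean K k₀ j / blockMean K k₀ j ^ 2 := by gcongr
        _ = (blockMean K k₀ j)⁻¹ := by have := (he0 j).ne'; field_simp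
        _ ≤ _ := inv_anti₀ (by linarith) (he j))
    (fun j => by
      have h2 := blockPairMean_le h0 h1 hK k₀ j
      have hpos : 0 < blockMean K k₀ j ^ 2 := pow_pos (he0 j) 2
      rw [div_le_iff₀ hpos]
      refine h2.trans ?_
      have h3 : 1 / 4 ≤ blockMean K k₀ j ^ 2 := by nlinarith [he j]
      have h4 : 0 ≤ 1 / √(2 ^ j * (q * 2 ^ (k₀ + 1))) := by positivity
      have h5 : 4 / √(2 ^ j * (q * 2 ^ (k₀ + 1))) = 4 * (1 / √(2 ^ j * (q * 2 ^ (k₀ + 1)))) := by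
        ring
      rw [h5]
      nlinarith)
  rw [Finset.prod_div_distrib, div_le_iff₀ (Finset.prod_pos fun j _ => pow_pos (he0 j) 2)] at hmain
  linarith

/-! ### Normalized densities and their second moments -/

/-- Product of the cutoffs over the first `J` blocks, normalized to have expectation one. -/
def density (K k₀ J : ℕ) (τ : ℝ) (ω : Site → ℕ → ℝ × ℤˣ) : ENNReal :=
  (∏ j ∈ Finset.range J, ENNReal.ofReal (blockMean K k₀ j))⁻¹ *
    ∏ j ∈ Finset.range J, ENNReal.ofReal (blockBump K k₀ (arrows τ ω) j)

lemma measurable_density (K k₀ J : ℕ) :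
    Measurable fun p : ℝ × (Site → ℕ → ℝ × ℤˣ) => density K k₀ J p.1 p.2 := by
  refine Measurable.const_mul (Finset.measurable_fun_prod _ fun j _ => ?_) _
  refine (measurable_of_countable fun w => ENNReal.ofReal
    (bump (blockStart K k₀ j).1.1 (blockHeight K k₀ j) w)).comp (measurable_walker
      (ξ := fun p : ℝ × (Site → ℕ → ℝ × ℤˣ) => arrows p.1 p.2) fun u _ => ?_)
  exact measurable_clockSign.comp
    (measurable_fst.prodMk ((measurable_pi_apply u).comp measurable_snd))

lemma measurable_density_comp {β : Type*} [MeasurableSpace β] {f : β → ℝ}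
    {g : β → Site → ℕ → ℝ × ℤˣ} (hf : Measurable f) (hg : Measurable g) (K k₀ J : ℕ) :
    Measurable fun x => density K k₀ J (f x) (g x) := by
  have := (measurable_density K k₀ J).comp (hf.prodMk hg)
  simpa only [Function.comp_def] using this

lemma density_le (K k₀ J : ℕ) (τ : ℝ) (ω : Site → ℕ → ℝ × ℤˣ) :
    density K k₀ J τ ω ≤ (∏ j ∈ Finset.range J, ENNReal.ofReal (blockMean K k₀ j))⁻¹ := by
  refine mul_le_of_le_one_right' (Finset.prod_le_one' fun j _ => ?_)
  exact ENNReal.ofReal_le_one.2 (bump_le_one _ _ _)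

lemma blockBump_pos_of_density_ne_zero {K k₀ J : ℕ} {τ : ℝ} {ω : Site → ℕ → ℝ × ℤˣ}
    (h : density K k₀ J τ ω ≠ 0) {j : ℕ} (hj : j < J) : 0 < blockBump K k₀ (arrows τ ω) j := by
  have h5 := right_ne_zero_of_mul h
  rw [Finset.prod_ne_zero_iff] at h5
  exact ENNReal.ofReal_pos.1 (pos_iff_ne_zero.2 (h5 j (Finset.mem_range.2 hj)))

lemma blockMean_pos {K : ℕ} (hK : 4 ≤ K) (k₀ j : ℕ) : 0 < blockMean K k₀ j := by
  have hK4 : (4 : ℝ) ≤ K := by exact_mod_cast hK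
  have hhalf : 2 / (K : ℝ) ≤ 1 / 2 := by
    rw [div_le_div_iff₀ (by linarith) two_pos]; linarith
  linarith [le_blockMean (by omega : 0 < K) k₀ j]

lemma prod_blockMean_ne_zero {K : ℕ} (hK : 4 ≤ K) (k₀ J : ℕ) :
    ∏ j ∈ Finset.range J, ENNReal.ofReal (blockMean K k₀ j) ≠ 0 :=
  Finset.prod_ne_zero_iff.2 fun j _ => (ENNReal.ofReal_pos.2 (blockMean_pos hK k₀ j)).ne'

lemma prod_blockMean_ne_top (K k₀ J : ℕ) :
    ∏ j ∈ Finset.range J, ENNReal.ofReal (blockMean K k₀ j) ≠ ⊤ :=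
  ENNReal.prod_ne_top fun _ _ => ENNReal.ofReal_ne_top

lemma blockStart_succ_level (K k₀ j : ℕ) :
    (blockStart K k₀ (j + 1)).1.2 = (blockStart K k₀ j).1.2 + blockTime k₀ j := rfl

lemma lintegral_density {K : ℕ} (hK : 4 ≤ K) (k₀ J : ℕ) (τ : ℝ) :
    ∫⁻ ω, density K k₀ J τ ω ∂systemLaw = 1 := by
  -- The one-time expectation is the pair statement at equal times, for a function of the first
  -- walker alone.
  have h := (isPairField_arrows τ τ).lintegral_prod (flipProb_nonneg τ τ) (flipProb_le_one τ τ)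
    (blockStart_succ_level K k₀) (g := fun j s =>
      bump (blockStart K k₀ j).1.1 (blockHeight K k₀ j) s.1) (fun j s => bump_nonneg _ _ _) J
  simp only [pairAvg_iterate_fst] at h
  simp only [density]
  rw [lintegral_const_mul' _ _ (ENNReal.inv_ne_top.2 (prod_blockMean_ne_zero hK k₀ J))]
  refine Eq.trans (congrArg _ h) ?_
  exact ENNReal.inv_mul_cancel (prod_blockMean_ne_zero hK k₀ J) (prod_blockMean_ne_top K k₀ J)

lemma lintegral_density_mul {K : ℕ} (hK : 4 ≤ K) (k₀ J : ℕ) (s t : ℝ) :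
    ∫⁻ ω, density K k₀ J s ω * density K k₀ J t ω ∂systemLaw =
      ENNReal.ofReal ((∏ j ∈ Finset.range J, blockPairMean (flipProb s t) K k₀ j) /
        ∏ j ∈ Finset.range J, blockMean K k₀ j ^ 2) := by
  have h := (isPairField_arrows s t).lintegral_prod (flipProb_nonneg s t) (flipProb_le_one s t)
    (blockStart_succ_level K k₀) (g := fun j s =>
      bump (blockStart K k₀ j).1.1 (blockHeight K k₀ j) s.1 *
        bump (blockStart K k₀ j).1.1 (blockHeight K k₀ j) s.2)
    (fun j s => mul_nonneg (bump_nonneg _ _ _) (bump_nonneg _ _ _)) J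
  have hne := prod_blockMean_ne_zero hK k₀ J
  set c := ∏ j ∈ Finset.range J, ENNReal.ofReal (blockMean K k₀ j) with hc
  have e1 : ∀ ω, density K k₀ J s ω * density K k₀ J t ω = (c⁻¹ * c⁻¹) *
      ∏ j ∈ Finset.range J, ENNReal.ofReal (blockBump K k₀ (arrows s ω) j *
        blockBump K k₀ (arrows t ω) j) := by
    intro ω
    simp only [density, ← hc, ENNReal.ofReal_mul (bump_nonneg _ _ _), blockBump,
      Finset.prod_mul_distrib]
    ring
  simp_rw [e1]
  rw [lintegral_const_mul' _ _ (ENNReal.mul_ne_top (ENNReal.inv_ne_top.2 hne)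
    (ENNReal.inv_ne_top.2 hne))]
  refine Eq.trans (congrArg _ h) ?_
  have hpos : 0 < ∏ j ∈ Finset.range J, blockMean K k₀ j :=
    Finset.prod_pos fun j _ => blockMean_pos hK k₀ j
  have e2 : c = ENNReal.ofReal (∏ j ∈ Finset.range J, blockMean K k₀ j) :=
    (ENNReal.ofReal_prod_of_nonneg fun j _ => (blockMean_pos hK k₀ j).le).symm
  rw [Finset.prod_pow, ENNReal.ofReal_div_of_pos (by positivity), ENNReal.ofReal_pow hpos.le, ← e2,
    ENNReal.ofReal_prod_of_nonneg fun j _ => blockPairMean_nonneg (flipProb_nonneg s t)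
      (flipProb_le_one s t) K k₀ j, div_eq_mul_inv, mul_comm, sq,
    ENNReal.mul_inv (Or.inl hne) (Or.inr hne)]
  rfl

attribute [irreducible] density

/-- Second moment bound for the normalized densities. -/
lemma exists_lintegral_density_mul_le {b : ℝ} (hb : 0 < b) (hb' : b ≤ 1 / 2) :
    ∃ K : ℕ, 4 ≤ K ∧ ∃ δ : ℕ → ENNReal, (∀ k, δ k ≠ 0) ∧ (∀ k, δ k ≠ ⊤) ∧
      Tendsto δ atTop (nhds 0) ∧ ∀ (k₀ J : ℕ), ∀ s ∈ Set.Icc (0 : ℝ) 1, ∀ t ∈ Set.Icc (0 : ℝ) 1,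
        ∫⁻ ω, density K k₀ J s ω * density K k₀ J t ω ∂systemLaw ≤
          1 + δ k₀ * edist s t ^ (-b) := by
  obtain ⟨K, hK, A, hA, hprod⟩ := exists_prod_blockPairMean_le hb hb'
  set c : ℝ := Real.exp (-1) / 2 with hc
  have hc0 : 0 < c := by positivity
  -- Starting at a larger scale decorrelates the two times: this tends to zero with `k`.
  set d : ℕ → ℝ := fun k => A * (c * 2 ^ (k + 1)) ^ (-b) with hd
  have hd0 : ∀ k, 0 < d k := fun k => by positivity
  refine ⟨K, hK, fun k => ENNReal.ofReal (d k), fun k => (ENNReal.ofReal_pos.2 (hd0 k)).ne',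
    fun k => ENNReal.ofReal_ne_top, ?_, fun k₀ J s hs t ht => ?_⟩
  · have h1 : Tendsto (fun k : ℕ => c * (2 : ℝ) ^ (k + 1)) atTop atTop :=
      ((tendsto_pow_atTop_atTop_of_one_lt one_lt_two).comp
        (tendsto_add_atTop_nat 1)).const_mul_atTop hc0
    have h2 : Tendsto d atTop (nhds (A * 0)) :=
      ((tendsto_rpow_neg_atTop hb).comp h1).const_mul A
    rw [mul_zero] at h2
    simpa using ENNReal.tendsto_ofReal h2
  -- On the diagonal the right side is infinite because `0 ^ (-b) = ⊤`; the product bound needs `q >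
  -- 0`.
  rcases eq_or_ne s t with rfl | hst
  · have : (edist s s : ENNReal) ^ (-b) = ⊤ := by simp [hb]
    rw [this, ENNReal.mul_top (ENNReal.ofReal_pos.2 (hd0 k₀)).ne']
    simp
  have hu : 0 < |s - t| := abs_pos.2 (sub_ne_zero.2 hst)
  have hq : c * |s - t| ≤ flipProb s t := le_flipProb hs ht
  have hq0 : 0 < flipProb s t := lt_of_lt_of_le (by positivity) hq
  rw [lintegral_density_mul hK, edist_dist, Real.dist_eq, ENNReal.ofReal_rpow_of_pos hu,
    ← ENNReal.ofReal_mul (hd0 k₀).le, ← ENNReal.ofReal_one,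
    ← ENNReal.ofReal_add zero_le_one (mul_nonneg (hd0 k₀).le (by positivity))]
  refine ENNReal.ofReal_le_ofReal ?_
  rw [div_le_iff₀ (Finset.prod_pos fun j _ => pow_pos (blockMean_pos hK k₀ j) 2), mul_comm (1 + _)]
  refine (hprod k₀ J _ hq0 (flipProb_le_one s t)).trans ?_
  have hp : (0 : ℝ) ≤ ∏ j ∈ Finset.range J, blockMean K k₀ j ^ 2 :=
    Finset.prod_nonneg fun j _ => sq_nonneg _
  refine mul_le_mul_of_nonneg_left ?_ hp
  simp only [hd]
  rw [mul_assoc, ← Real.mul_rpow (by positivity) hu.le]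
  gcongr 1 + A * ?_
  refine Real.rpow_le_rpow_of_nonpos (by positivity) ?_ (by linarith)
  calc c * 2 ^ (k₀ + 1) * |s - t| = c * |s - t| * 2 ^ (k₀ + 1) := by ring
    _ ≤ _ := by gcongr

/-! ### Random measures on dynamical times: mass and energy -/

/-- Lebesgue measure on the unit interval of dynamical times. -/
def unitTime : Measure ℝ := volume.restrict (Set.Icc 0 1)

instance : IsProbabilityMeasure unitTime := ⟨by simp [unitTime]⟩

lemma ae_unitTime : ∀ᵐ s ∂unitTime, s ∈ Set.Icc (0 : ℝ) 1 :=
  ae_restrict_mem measurableSet_Icc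

/-- Random measure on the times at which the walk passes the first `J` cutoffs. -/
def timeMeasure (K k₀ J : ℕ) (ω : Site → ℕ → ℝ × ℤˣ) : Measure ℝ :=
  unitTime.withDensity fun τ => density K k₀ J τ ω

lemma measurable_density_left (K k₀ J : ℕ) (ω : Site → ℕ → ℝ × ℤˣ) :
    Measurable fun τ => density K k₀ J τ ω :=
  measurable_density_comp measurable_id measurable_const K k₀ J

lemma timeMeasure_univ (K k₀ J : ℕ) (ω : Site → ℕ → ℝ × ℤˣ) :
    timeMeasure K k₀ J ω Set.univ = ∫⁻ τ, density K k₀ J τ ω ∂unitTime := by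
  rw [timeMeasure, withDensity_apply _ MeasurableSet.univ, Measure.restrict_univ]

lemma isFiniteMeasure_timeMeasure {K : ℕ} (hK : 4 ≤ K) (k₀ J : ℕ) (ω : Site → ℕ → ℝ × ℤˣ) :
    IsFiniteMeasure (timeMeasure K k₀ J ω) := by
  refine ⟨?_⟩
  rw [timeMeasure_univ]
  refine (lintegral_mono fun τ => density_le K k₀ J τ ω).trans_lt ?_
  rw [lintegral_const, measure_univ, mul_one]
  exact (ENNReal.inv_ne_top.2 (prod_blockMean_ne_zero hK k₀ J)).lt_top

lemma measurable_edist_rpow (a : ℝ) : Measurable fun p : ℝ × ℝ => edist p.1 p.2 ^ a :=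
  (measurable_fst.edist measurable_snd).pow_const _

lemma measurable_edist_rpow_right (a s : ℝ) : Measurable fun t : ℝ => edist s t ^ a :=
  (measurable_const.edist measurable_id).pow_const _

lemma energy_timeMeasure (α : ℝ) (K k₀ J : ℕ) (ω : Site → ℕ → ℝ × ℤˣ) :
    energy α (timeMeasure K k₀ J ω) =
      ∫⁻ s, ∫⁻ t, edist s t ^ (-α) * (density K k₀ J s ω * density K k₀ J t ω) ∂unitTime
        ∂unitTime := by
  have hk := measurable_edist_rpow (-α)
  have hd := measurable_density_left K k₀ J ω
  have h1 : ∀ s, ∫⁻ t, edist s t ^ (-α) ∂timeMeasure K k₀ J ω =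
      ∫⁻ t, density K k₀ J t ω * edist s t ^ (-α) ∂unitTime := fun s => by
    rw [timeMeasure, lintegral_withDensity_eq_lintegral_mul _ hd
      (measurable_edist_rpow_right (-α) s)]
    rfl
  have hm : Measurable fun s => ∫⁻ t, density K k₀ J t ω * edist s t ^ (-α) ∂unitTime :=
    Measurable.lintegral_prod_right' (f := fun p : ℝ × ℝ =>
      density K k₀ J p.2 ω * edist p.1 p.2 ^ (-α)) ((hd.comp measurable_snd).mul hk)
  simp only [energy, h1]
  rw [timeMeasure, lintegral_withDensity_eq_lintegral_mul _ hd hm]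
  refine lintegral_congr fun s => ?_
  have hds : Measurable fun t => density K k₀ J t ω * edist s t ^ (-α) :=
    hd.mul (measurable_edist_rpow_right (-α) s)
  rw [Pi.mul_apply, ← lintegral_const_mul _ hds]
  refine lintegral_congr fun t => ?_
  ring

lemma measurable_kernel_mul_density (K k₀ J : ℕ) {κ : ℝ → ℝ → ENNReal}
    (hκ : Measurable fun p : ℝ × ℝ => κ p.1 p.2) :
    Measurable fun p : ((Site → ℕ → ℝ × ℤˣ) × ℝ) × ℝ =>
      κ p.1.2 p.2 * (density K k₀ J p.1.2 p.1.1 * density K k₀ J p.2 p.1.1) :=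
  (hκ.comp ((measurable_snd.comp measurable_fst).prodMk measurable_snd)).mul
    ((measurable_density_comp (measurable_snd.comp measurable_fst)
      (measurable_fst.comp measurable_fst) K k₀ J).mul
      (measurable_density_comp measurable_snd (measurable_fst.comp measurable_fst) K k₀ J))

/-- Expectations of weighted double integrals of the densities. -/
lemma lintegral_double_density_le {K : ℕ} {k₀ J : ℕ} {b : ℝ} {δ : ENNReal}
    (hδ : ∀ s ∈ Set.Icc (0 : ℝ) 1, ∀ t ∈ Set.Icc (0 : ℝ) 1,
      ∫⁻ ω, density K k₀ J s ω * density K k₀ J t ω ∂systemLaw ≤ 1 + δ * edist s t ^ (-b))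
    {κ : ℝ → ℝ → ENNReal} (hκ : Measurable fun p : ℝ × ℝ => κ p.1 p.2) :
    ∫⁻ ω, ∫⁻ s, ∫⁻ t, κ s t * (density K k₀ J s ω * density K k₀ J t ω) ∂unitTime ∂unitTime
        ∂systemLaw ≤
      ∫⁻ s, ∫⁻ t, κ s t * (1 + δ * edist s t ^ (-b)) ∂unitTime ∂unitTime := by
  have hjoint := measurable_kernel_mul_density K k₀ J hκ
  rw [lintegral_lintegral_swap (f := fun ω s => ∫⁻ t, κ s t *
    (density K k₀ J s ω * density K k₀ J t ω) ∂unitTime) hjoint.lintegral_prod_right'.aemeasurable]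
  refine lintegral_mono_ae ?_
  filter_upwards [ae_unitTime] with s hs
  have hjs : Measurable fun p : (Site → ℕ → ℝ × ℤˣ) × ℝ =>
      κ s p.2 * (density K k₀ J s p.1 * density K k₀ J p.2 p.1) :=
    hjoint.comp ((measurable_fst.prodMk measurable_const).prodMk measurable_snd)
  rw [lintegral_lintegral_swap (f := fun ω t => κ s t *
    (density K k₀ J s ω * density K k₀ J t ω)) hjs.aemeasurable]
  refine lintegral_mono_ae ?_
  filter_upwards [ae_unitTime] with t ht
  have hst : Measurable fun ω => density K k₀ J s ω * density K k₀ J t ω :=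
    (measurable_density_comp measurable_const measurable_id K k₀ J).mul
      (measurable_density_comp measurable_const measurable_id K k₀ J)
  rw [lintegral_const_mul _ hst]
  gcongr
  exact hδ s hs t ht

lemma exists_lintegral_lintegral_edist_rpow_le {β : ℝ} (hβ : β < 1) :
    ∃ C : ENNReal, C ≠ ⊤ ∧ ∫⁻ s, ∫⁻ t, edist s t ^ (-β) ∂unitTime ∂unitTime ≤ C := by
  obtain ⟨C, hC, h⟩ := exists_lintegral_edist_rpow_le hβ
  refine ⟨C, hC, ?_⟩
  calc _ ≤ ∫⁻ _, C ∂unitTime := by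
        refine lintegral_mono_ae ?_
        filter_upwards [ae_unitTime] with s hs using h s hs
    _ = C := by rw [lintegral_const, measure_univ, mul_one]

lemma edist_rpow_mul {a b : ℝ} (ha : 0 < a) (hb : 0 < b) (s t : ℝ) :
    edist s t ^ (-a) * edist s t ^ (-b) = edist s t ^ (-(a + b)) := by
  rcases eq_or_ne s t with rfl | h
  · have h1 : (-a) < 0 := by linarith
    have h2 : (-b) < 0 := by linarith
    have h3 : (-(a + b)) < 0 := by linarith
    rw [edist_self, ENNReal.zero_rpow_of_neg h1, ENNReal.zero_rpow_of_neg h2,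
      ENNReal.zero_rpow_of_neg h3, ENNReal.top_mul_top]
  · rw [← ENNReal.rpow_add _ _ (by simpa using h) (edist_ne_top _ _)]
    congr 1
    ring

/-- Chebyshev's inequality `1 / 4 ≤ (m - 1) ^ 2` for `m < 1 / 2`, arranged without subtraction. -/
lemma quarter_indicator_add_le (m : ENNReal) :
    (Set.Iio (1 / 2 : ENNReal)).indicator (fun _ => 1 / 4) m + 2 * m ≤ m * m + 1 := by
  rcases eq_or_ne m ⊤ with rfl | hm
  · simp
  lift m to NNReal using hm
  by_cases h : (m : ENNReal) ∈ Set.Iio (1 / 2 : ENNReal)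
  · rw [Set.indicator_of_mem h]
    have h' : m < 1 / 2 := by
      have : (m : ENNReal) < ((1 / 2 : NNReal) : ENNReal) := by
        simpa using h
      exact_mod_cast this
    have h2 : (1 / 4 : NNReal) + 2 * m ≤ m * m + 1 := by
      rw [← NNReal.coe_le_coe]
      have h3 : (m : ℝ) < 1 / 2 := by exact_mod_cast h'
      push_cast
      nlinarith
    have h4 : (1 / 4 : ENNReal) = ((1 / 4 : NNReal) : ENNReal) := by simp
    rw [h4]
    exact_mod_cast h2
  · rw [Set.indicator_of_notMem h, zero_add]
    have h2 : 2 * m ≤ m * m + 1 := by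
      rw [← NNReal.coe_le_coe]
      push_cast
      nlinarith [sq_nonneg ((m : ℝ) - 1)]
    exact_mod_cast h2

lemma measurable_lintegral_density (K k₀ J : ℕ) :
    Measurable fun ω => ∫⁻ τ, density K k₀ J τ ω ∂unitTime :=
  (measurable_density_comp (β := (Site → ℕ → ℝ × ℤˣ) × ℝ) measurable_snd measurable_fst
    K k₀ J).lintegral_prod_right'

/-- The random measures have mass at least one half with high probability. -/
lemma measure_mass_lt_le {K : ℕ} (hK : 4 ≤ K) {k₀ J : ℕ} {b : ℝ} {δ C : ENNReal}
    (hδ : ∀ s ∈ Set.Icc (0 : ℝ) 1, ∀ t ∈ Set.Icc (0 : ℝ) 1,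
      ∫⁻ ω, density K k₀ J s ω * density K k₀ J t ω ∂systemLaw ≤ 1 + δ * edist s t ^ (-b))
    (hC : ∫⁻ s, ∫⁻ t, edist s t ^ (-b) ∂unitTime ∂unitTime ≤ C) (hδt : δ ≠ ⊤) :
    systemLaw {ω | timeMeasure K k₀ J ω Set.univ < 1 / 2} ≤ 4 * (δ * C) := by
  set m : (Site → ℕ → ℝ × ℤˣ) → ENNReal := fun ω => ∫⁻ τ, density K k₀ J τ ω ∂unitTime with hm
  have hmm : Measurable m := measurable_lintegral_density K k₀ J
  have hmean : ∫⁻ ω, m ω ∂systemLaw = 1 := by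
    rw [hm, lintegral_lintegral_swap (f := fun ω τ => density K k₀ J τ ω)
      (measurable_density_comp measurable_snd measurable_fst K k₀ J).aemeasurable]
    simp [lintegral_density hK]
  have hsq : ∫⁻ ω, m ω * m ω ∂systemLaw ≤ 1 + δ * C := by
    have h1 := lintegral_double_density_le hδ (κ := fun _ _ => 1) measurable_const
    have h2 : ∀ ω, ∫⁻ s, ∫⁻ t, 1 * (density K k₀ J s ω * density K k₀ J t ω) ∂unitTime ∂unitTime
        = m ω * m ω := fun ω => by
      simp only [one_mul]
      exact lintegral_lintegral_mul (measurable_density_left K k₀ J ω).aemeasurable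
        (measurable_density_left K k₀ J ω).aemeasurable
    simp only [h2] at h1
    refine h1.trans ?_
    simp only [one_mul]
    have h3 : ∀ s, ∫⁻ t, (1 + δ * edist s t ^ (-b)) ∂unitTime =
        1 + δ * ∫⁻ t, edist s t ^ (-b) ∂unitTime := fun s => by
      rw [lintegral_add_left measurable_const, lintegral_const, measure_univ, mul_one,
        lintegral_const_mul' _ _ hδt]
    simp only [h3]
    rw [lintegral_add_left measurable_const, lintegral_const, measure_univ, mul_one,
      lintegral_const_mul' _ _ hδt]
    gcongr
  have hS : MeasurableSet (m ⁻¹' Set.Iio (1 / 2)) := hmm measurableSet_Iio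
  have hbound_int := lintegral_mono (μ := systemLaw) fun ω => quarter_indicator_add_le (m ω)
  rw [lintegral_add_right _ (hmm.const_mul 2), lintegral_const_mul _ hmm, hmean,
    lintegral_add_right _ measurable_const, lintegral_const, measure_univ, mul_one,
    mul_one] at hbound_int
  have hind : ∫⁻ ω, (Set.Iio (1 / 2 : ENNReal)).indicator (fun _ => 1 / 4) (m ω) ∂systemLaw =
      1 / 4 * systemLaw (m ⁻¹' Set.Iio (1 / 2)) := by
    rw [← lintegral_indicator_const hS]
    rfl
  rw [hind] at hbound_int
  have h4 : 1 / 4 * systemLaw (m ⁻¹' Set.Iio (1 / 2)) + 2 ≤ δ * C + 2 :=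
    hbound_int.trans (by
      calc _ ≤ 1 + δ * C + 1 := by gcongr
        _ = δ * C + 2 := by ring)
  have h5 : 1 / 4 * systemLaw (m ⁻¹' Set.Iio (1 / 2)) ≤ δ * C :=
    (ENNReal.add_le_add_iff_right (by simp)).1 h4
  have h6 : {ω | timeMeasure K k₀ J ω Set.univ < 1 / 2} = m ⁻¹' Set.Iio (1 / 2) := by
    ext ω
    simp [timeMeasure_univ, hm]
  rw [h6]
  calc _ = 4 * (1 / 4 * systemLaw (m ⁻¹' Set.Iio (1 / 2))) := by
        rw [← mul_assoc, ENNReal.mul_div_cancel (by simp) (by simp), one_mul]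
    _ ≤ _ := by gcongr

/-- Uniform bound for the expected energies. -/
lemma exists_lintegral_energy_le {K : ℕ} {k₀ : ℕ} {α b : ℝ} (hα : 0 < α) (hb : 0 < b)
    (hαb : α + b < 1) {δ : ENNReal} (hδt : δ ≠ ⊤)
    (hδ : ∀ J, ∀ s ∈ Set.Icc (0 : ℝ) 1, ∀ t ∈ Set.Icc (0 : ℝ) 1,
      ∫⁻ ω, density K k₀ J s ω * density K k₀ J t ω ∂systemLaw ≤ 1 + δ * edist s t ^ (-b)) :
    ∃ C : ENNReal, C ≠ ⊤ ∧ ∀ J, ∫⁻ ω, energy α (timeMeasure K k₀ J ω) ∂systemLaw ≤ C := by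
  obtain ⟨C₁, hC₁, h₁⟩ := exists_lintegral_lintegral_edist_rpow_le (β := α) (by linarith)
  obtain ⟨C₂, hC₂, h₂⟩ := exists_lintegral_lintegral_edist_rpow_le hαb
  refine ⟨C₁ + δ * C₂, ENNReal.add_ne_top.2 ⟨hC₁, ENNReal.mul_ne_top hδt hC₂⟩, fun J => ?_⟩
  simp only [energy_timeMeasure]
  refine (lintegral_double_density_le (hδ J) (κ := fun s t => edist s t ^ (-α))
    (measurable_edist_rpow _)).trans ?_
  -- The kernel splits into Riesz kernels of orders `α` and `α + b`, both below one and hence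
  -- integrable.
  have e1 : ∀ s, ∫⁻ t, edist s t ^ (-α) * (1 + δ * edist s t ^ (-b)) ∂unitTime =
      ∫⁻ t, edist s t ^ (-α) ∂unitTime + δ * ∫⁻ t, edist s t ^ (-(α + b)) ∂unitTime := fun s => by
    rw [← lintegral_const_mul' _ _ hδt, ← lintegral_add_left (measurable_edist_rpow_right (-α) s)]
    refine lintegral_congr fun t => ?_
    rw [← edist_rpow_mul hα hb]
    ring
  simp only [e1]
  rw [lintegral_add_left (measurable_edist_rpow (-α)).lintegral_prod_right',
    lintegral_const_mul' _ _ hδt]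
  gcongr

/-! ### Good times and the almost sure dimension -/

/-- Times in the unit interval at which the walk passes the first `J` cutoffs. -/
def goodTimes (K k₀ J : ℕ) (ω : Site → ℕ → ℝ × ℤˣ) : Set ℝ :=
  {τ | τ ∈ Set.Icc (0 : ℝ) 1 ∧ ∀ j < J, 0 < blockBump K k₀ (arrows τ ω) j}

lemma goodTimes_antitone (K k₀ : ℕ) (ω : Site → ℕ → ℝ × ℤˣ) :
    Antitone fun J => goodTimes K k₀ J ω :=
  fun _ _ h _ hτ => ⟨hτ.1, fun j hj => hτ.2 j (lt_of_lt_of_le hj h)⟩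

lemma timeMeasure_goodTimes_compl {K : ℕ} (k₀ J : ℕ) (ω : Site → ℕ → ℝ × ℤˣ) :
    timeMeasure K k₀ J ω (goodTimes K k₀ J ω)ᶜ = 0 := by
  have hd := measurable_density_left K k₀ J ω
  have h0 : ∀ᵐ τ ∂timeMeasure K k₀ J ω, τ ∈ Set.Icc (0 : ℝ) 1 :=
    (withDensity_absolutelyContinuous _ _).ae_le ae_unitTime
  have h1 : ∀ᵐ τ ∂timeMeasure K k₀ J ω, density K k₀ J τ ω ≠ 0 := by
    rw [timeMeasure, ae_withDensity_iff hd]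
    exact Eventually.of_forall fun τ h => h
  have h2 : ∀ᵐ τ ∂timeMeasure K k₀ J ω, τ ∈ goodTimes K k₀ J ω := by
    filter_upwards [h0, h1] with τ h3 h4
    refine ⟨h3, fun j hj => ?_⟩
    exact blockBump_pos_of_density_ne_zero h4 hj
  exact h2

/-- Near a limit of good times that is not a ring time, each block walk is constant in `τ`, so its
cutoff is positive at the limit too. -/
lemma iInter_closure_goodTimes_subset {K k₀ : ℕ} {ω : Site → ℕ → ℝ × ℤˣ}
    (hω : ∀ z, Regular (ω z)) :
    (⋂ J, closure (goodTimes K k₀ J ω)) ⊆ (⋂ J, goodTimes K k₀ J ω) ∪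
      Set.range fun p : Site × ℕ => ∑ k ∈ Finset.range (p.2 + 1), (ω p.1 k).1 := by
  intro τ hτ
  by_cases hring : τ ∈ Set.range fun p : Site × ℕ => ∑ k ∈ Finset.range (p.2 + 1), (ω p.1 k).1
  · exact Or.inr hring
  refine Or.inl (Set.mem_iInter.2 fun J => ?_)
  have hne : ∀ z n, ∑ k ∈ Finset.range (n + 1), (ω z k).1 ≠ τ := fun z n h => hring ⟨(z, n), h⟩
  have hJ : τ ∈ closure (goodTimes K k₀ J ω) := Set.mem_iInter.1 hτ J
  refine ⟨closure_minimal (fun _ h => h.1) isClosed_Icc hJ, fun j hj => ?_⟩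
  have hev := eventually_walker_eq hω hne (blockStart K k₀ j) (blockTime k₀ j)
  obtain ⟨τ', h1, h2⟩ := (mem_closure_iff_frequently.1 hJ |>.and_eventually hev).exists
  have h3 := h1.2 j hj
  rw [blockBump] at h3 ⊢
  rwa [h2] at h3

/-- Times at which the walk from the origin is subdiffusive. -/
def subdiffusiveTimes (ω : Site → ℕ → ℝ × ℤˣ) : Set ℝ :=
  {τ | 0 ≤ τ ∧ Subdiffusive fun n => (follow (arrows τ ω) origin n).1.1}

lemma iInter_goodTimes_subset {K : ℕ} (hK : 0 < K) (k₀ : ℕ) (ω : Site → ℕ → ℝ × ℤˣ) :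
    (⋂ J, goodTimes K k₀ J ω) ⊆ subdiffusiveTimes ω := fun τ hτ => by
  rw [Set.mem_iInter] at hτ
  exact ⟨(hτ 0).1.1, subdiffusive_of_blockBump_pos hK k₀ fun j => (hτ (j + 1)).2 j (by omega)⟩

lemma ae_forall_regular : ∀ᵐ ω ∂systemLaw, ∀ z, Regular (ω z) :=
  ae_all_iff.2 fun z =>
    (measurePreserving_eval_infinitePi (fun _ : Site => clockLaw) z).quasiMeasurePreserving.ae
      ae_regular

/-- Events of uniformly small probability rarely hold eventually. -/
lemma measure_eventually_le {Ω : Type*} [MeasurableSpace Ω] (P : Measure Ω) {B : ℕ → Set Ω}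
    {κ : ENNReal} (h : ∀ n, P (B n) ≤ κ) : P {ω | ∀ᶠ n in atTop, ω ∈ B n} ≤ κ := by
  have e : {ω | ∀ᶠ n in atTop, ω ∈ B n} = ⋃ N, ⋂ n ≥ N, B n := by
    ext ω
    simp [eventually_atTop]
  have hmono : Monotone fun N => ⋂ n ≥ N, B n := fun N M hNM ω hω => by
    simp only [Set.mem_iInter] at hω ⊢
    exact fun n hn => hω n (le_trans hNM hn)
  rw [e, hmono.measure_iUnion]
  exact iSup_le fun N => (measure_mono (Set.biInter_subset_of_mem (le_refl N))).trans (h N)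

/-- The set of subdiffusive times does not depend on `k₀`, so the failure bound may be sent to zero
with `k₀ → ∞`. For fixed `k₀` it suffices that mass and energy are good for infinitely many `J`,
which allows `J` to depend on `ω`. -/
lemma ae_le_dimH_subdiffusiveTimes {α : NNReal} (hα : 0 < α) (hα1 : α < 1) :
    ∀ᵐ ω ∂systemLaw, (α : ENNReal) ≤ dimH (subdiffusiveTimes ω) := by
  have hα' : (0 : ℝ) < α := hα
  have hα1' : (α : ℝ) < 1 := hα1
  set b : ℝ := (1 - α) / 2 with hb
  have hb0 : 0 < b := by rw [hb]; linarith
  have hb1 : b ≤ 1 / 2 := by rw [hb]; linarith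
  have hαb : (α : ℝ) + b < 1 := by rw [hb]; linarith
  obtain ⟨K, hK, δ, hδ0, hδt, hδlim, hδ⟩ := exists_lintegral_density_mul_le hb0 hb1
  obtain ⟨Cb, hCb, hCb'⟩ := exists_lintegral_lintegral_edist_rpow_le (β := b) (by linarith)
  have hbound : ∀ k₀, systemLaw {ω | ¬ (α : ENNReal) ≤ dimH (subdiffusiveTimes ω)} ≤
      4 * (δ k₀ * Cb) + δ k₀ := by
    intro k₀
    obtain ⟨CE, hCE, hE⟩ := exists_lintegral_energy_le hα' hb0 hαb (hδt k₀) (hδ k₀)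
    -- Markov's inequality then gives probability at most `δ k₀`; the `+ 1` keeps `C` nonzero.
    set C : ENNReal := (CE + 1) / δ k₀ with hC
    have hCt : C ≠ ⊤ := ENNReal.div_ne_top (by simp [hCE]) (hδ0 k₀)
    have hC0 : C ≠ 0 := by simp [hC, hδt k₀]
    set B : ℕ → Set (Site → ℕ → ℝ × ℤˣ) := fun J =>
      {ω | timeMeasure K k₀ J ω Set.univ < 1 / 2} ∪
        {ω | C ≤ energy α (timeMeasure K k₀ J ω)} with hB
    have hBle : ∀ J, systemLaw (B J) ≤ 4 * (δ k₀ * Cb) + δ k₀ := by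
      intro J
      refine (measure_union_le _ _).trans (add_le_add
        (measure_mass_lt_le hK (hδ k₀ J) hCb' (hδt k₀)) ?_)
      have hEm : Measurable fun ω => energy α (timeMeasure K k₀ J ω) := by
        simp only [energy_timeMeasure]
        exact (measurable_kernel_mul_density K k₀ J
          (κ := fun s t => edist s t ^ (-(α : ℝ))) (measurable_edist_rpow (-(α : ℝ))))
          |>.lintegral_prod_right'.lintegral_prod_right'
      have h1 := (mul_meas_ge_le_lintegral (μ := systemLaw) hEm C).trans (hE J)
      have h2 : C * systemLaw {ω | C ≤ energy α (timeMeasure K k₀ J ω)} ≤ C * δ k₀ := by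
        refine h1.trans ?_
        rw [hC, ENNReal.div_mul_cancel (hδ0 k₀) (hδt k₀)]
        exact le_self_add
      exact (ENNReal.mul_le_mul_iff_right hC0 hCt).1 h2
    -- Failure of the dimension bound forces all large `J` to be bad. Only monotonicity is used, so
    -- the failure event need not be measurable.
    refine le_trans (measure_mono_ae ?_) (measure_eventually_le systemLaw hBle)
    filter_upwards [ae_forall_regular] with ω hω hnot
    by_contra hcon
    refine hnot ?_
    have hfreq : ∃ᶠ J in atTop, 1 / 2 ≤ timeMeasure K k₀ J ω Set.univ ∧
        energy α (timeMeasure K k₀ J ω) ≤ C := by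
      refine (not_eventually.1 hcon).mono fun J hJ => ?_
      simp only [hB, Set.mem_union, not_or] at hJ
      exact ⟨not_lt.1 hJ.1, (not_le.1 hJ.2).le⟩
    have : ∀ J, IsFiniteMeasure (timeMeasure K k₀ J ω) := fun J =>
      isFiniteMeasure_timeMeasure hK k₀ J ω
    exact (le_dimH_of_energy_le hα (goodTimes_antitone K k₀ ω) (fun J τ hτ => hτ.1)
      (Set.countable_range _) (iInter_closure_goodTimes_subset hω)
      (timeMeasure_goodTimes_compl k₀ · ω) hCt hfreq).trans
      (dimH_mono (iInter_goodTimes_subset (by omega) k₀ ω))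
  have hlim : Tendsto (fun k₀ => 4 * (δ k₀ * Cb) + δ k₀) atTop (nhds (4 * (0 * Cb) + 0)) :=
    (ENNReal.Tendsto.const_mul (ENNReal.Tendsto.mul_const hδlim (Or.inr hCb))
      (Or.inr (by simp))).add hδlim
  rw [zero_mul, mul_zero, add_zero] at hlim
  rw [ae_iff]
  exact le_antisymm (ge_of_tendsto' hlim hbound) zero_le

lemma ae_dimH_subdiffusiveTimes : ∀ᵐ ω ∂systemLaw, 1 ≤ dimH (subdiffusiveTimes ω) := by
  obtain ⟨u, -, hu, hlim⟩ := exists_seq_strictMono_tendsto' (zero_lt_one (α := NNReal))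
  filter_upwards [ae_all_iff.2 fun n => ae_le_dimH_subdiffusiveTimes (hu n).1 (hu n).2] with ω hω
  have h := le_of_tendsto' (ENNReal.tendsto_coe.2 hlim) hω
  rwa [ENNReal.coe_one] at h

/-- The joint law of the driving variables. -/
lemma IsDriving.hasLaw_system {Ω : Type*} [MeasurableSpace Ω] {P : Measure Ω}
    [IsProbabilityMeasure P] {T : Site → ℕ → Ω → ℝ} {ε : Site → ℕ → Ω → ℤˣ}
    (h : IsDriving P T ε) :
    HasLaw (fun ω (z : Site) (n : ℕ) => (T z n ω, ε z n ω)) systemLaw P := by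
  have h1 : HasLaw (fun ω (p : Site × ℕ) => (T p.1 p.2 ω, ε p.1 p.2 ω))
      (Measure.infinitePi fun _ : Site × ℕ => tickLaw) P :=
    h.indep.hasLaw_infinitePi (fun p => h.hasLaw p.1 p.2)
      (aemeasurable_pi_iff.2 fun p => (h.hasLaw p.1 p.2).aemeasurable)
  have h2 : HasLaw (MeasurableEquiv.curry Site ℕ (ℝ × ℤˣ)) systemLaw
      (Measure.infinitePi fun _ : Site × ℕ => tickLaw) :=
    ⟨(MeasurableEquiv.measurable _).aemeasurable,
      Measure.infinitePi_map_curry fun (_ : Site) (_ : ℕ) => tickLaw⟩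
  exact h2.comp h1

end

end DyDW

theorem mainTheorem1 {Ω : Type*} [MeasurableSpace Ω] (P : MeasureTheory.Measure Ω)
    [MeasureTheory.IsProbabilityMeasure P]
    (T : DyDW.Site → ℕ → Ω → ℝ) (ε : DyDW.Site → ℕ → Ω → ℤˣ)
    (h : DyDW.IsDriving P T ε) :
    (∀ᵐ ω ∂P, dimH {τ : ℝ | 0 ≤ τ ∧ DyDW.Subdiffusive (DyDW.walk T ε τ ω)} = 1) ∧
    (∀ᵐ ω ∂P, dimH {τ : ℝ | 0 ≤ τ ∧ ¬ DyDW.ObeysLIL (DyDW.walk T ε τ ω)} = 1) := by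
  have hle : ∀ S : Set ℝ, dimH S ≤ 1 := fun S =>
    (dimH_mono (Set.subset_univ S)).trans Real.dimH_univ.le
  have hsys := h.hasLaw_system
  have hae : ∀ᵐ ω ∂P, 1 ≤ dimH {τ : ℝ | 0 ≤ τ ∧ DyDW.Subdiffusive (DyDW.walk T ε τ ω)} := by
    have := DyDW.ae_dimH_subdiffusiveTimes
    rw [← hsys.map_eq] at this
    -- Evaluated at the driving variables, `arrows` is `arrow` by definition, so the statement pulls
    -- back unchanged.
    exact ae_of_ae_map hsys.aemeasurable this
  constructor
  · filter_upwards [hae] with ω hω using le_antisymm (hle _) hω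
  · filter_upwards [hae] with ω hω
    exact le_antisymm (hle _) (hω.trans (dimH_mono fun τ hτ => ⟨hτ.1, hτ.2.not_obeysLIL⟩))
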